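/- There are constants $C_p\in(0,\infty)$, $p\in[1,\infty]$, depending only on $p$ and satisfying $\sup_{1\le p\le\infty}C_p<\infty$, such that the following holds. Let $T>0$, and let $v$ be a smooth, time-dependent, divergence-free vector field on $(0,T)\times\mathbb{R}^3$ that grows at most linearly in space, locally uniformly in time: for every $[a,b]\subset(0,T)$ there is $K$ with $|v(t,x)|\le K(1+|x|)$ for all $t\in[a,b]$ and $x\in\mathbb{R}^3$ (for instance, $v$ bounded on $[a,b]\times\mathbb{R}^3$). Let $\rho_0\in L^1(\mathbb{R}^3)$ and let $\rho\in C([0,T);L^1(\mathbb{R}^3))$, with $\rho(0)=\rho_0$, be real-valued, smooth on $(0,T)\times\mathbb{R}^3$, and satisfy there $$\partial_t\rho+v\cdot\nabla\rho-\Delta\rho=0 .$$ Then for every $p\in[1,\infty]$: (i) $\|\rho(t)\|_{L^p(\mathbb{R}^3)}\le\|\rho_0\|_{L^p(\mathbb{R}^3)}$ for all $t\in[0,T)$ (the right-hand side may be $+\infty$); (ii) $\|\rho(t)\|_{L^p(\mathbb{R}^3)}\le C_p\,t^{-\frac32\left(1-\frac1p\right)}\|\rho_0\|_{L^1(\mathbb{R}^3)}$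 for all $t\in(0,T)$ (with $1/p=0$ if $p=\infty$). -/

import Mathlib

open MeasureTheory Filter Set
open scoped Topology ENNReal ContDiff Laplacian

/-- Three-dimensional Euclidean space. -/
abbrev R3 : Type := EuclideanSpace ℝ (Fin 3)

/-- The divergence `∂₁ u₁ + ∂₂ u₂ + ∂₃ u₃` of a vector field on `ℝ³`. -/
noncomputable def divergence (u : R3 → R3) (x : R3) : ℝ :=
  ∑ i : Fin 3, (fderiv ℝ u x (EuclideanSpace.single i 1)) i

/-- `v` is a smooth divergence-free time-dependent velocity field on `(0,T) × ℝ³`, at most linearly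
growing in space, locally uniformly in time (bounded fields are a special case). -/
structure IsVelocityField (T : ℝ) (v : ℝ → R3 → R3) : Prop where
  smooth : ContDiffOn ℝ ∞ (fun q : ℝ × R3 => v q.1 q.2) (Ioo 0 T ×ˢ univ)
  div_free : ∀ t ∈ Ioo 0 T, ∀ x, divergence (v t) x = 0
  growth : ∀ a ∈ Ioo 0 T, ∀ b ∈ Ioo 0 T,
    ∃ K : ℝ, ∀ t ∈ Icc a b, ∀ x, ‖v t x‖ ≤ K * (1 + ‖x‖)

/-- `ρ` is a smooth solution on `(0,T) × ℝ³` of `∂ₜ ρ + v · ∇ρ - Δρ = 0`, belonging to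
`C([0,T); L¹(ℝ³))`, with initial datum `ρ₀`. Smoothness is only required at positive times. -/
structure IsSmoothSolution (T : ℝ) (v : ℝ → R3 → R3) (ρ₀ : R3 → ℝ) (ρ : ℝ → R3 → ℝ) : Prop where
  smooth : ContDiffOn ℝ ∞ (fun q : ℝ × R3 => ρ q.1 q.2) (Ioo 0 T ×ˢ univ)
  eqn : ∀ t ∈ Ioo 0 T, ∀ x,
    deriv (fun s => ρ s x) t + fderiv ℝ (ρ t) x (v t x) - (Δ (ρ t)) x = 0
  memL1 : ∀ t ∈ Ico 0 T, MemLp (ρ t) 1 volume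
  contL1 : ∀ s ∈ Ico 0 T,
    Tendsto (fun t => eLpNorm (ρ t - ρ s) 1 volume) (𝓝[Ico 0 T] s) (𝓝 0)
  initial : ρ 0 =ᵐ[volume] ρ₀

/-! Everything follows from one fact about solutions `w` whose positive part is integrable with
uniformly small tails: the transport term is invisible to functionals `∫ G(w)`, because the drift is
divergence-free. Testing with a cutoff `φ` at scale `R` leaves the error `∫ G(w)(v·∇φ + Δφ)`. Linear
growth of `v` against `|∇φ| ≤ C/R` keeps the weight bounded, so for `0 ≤ G(y) ≤ y₊` the error is at
most a multiple of the mass in `{|x| ≥ R}` and disappears as `R → ∞`. What remains is the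
dissipation `∫ G''(w)|∇w|²`.

Dropping the dissipation gives monotonicity of `∫ (w - k)₊` for every `k ≥ 0`
(`integral_posPart_antitone`). Applied to `ρ` and `-ρ`, with `L¹` continuity at time zero, this
controls `∫ (|ρ| - k)₊`. Powers `a ^ p` with `p > 1` are superpositions of the functions `(a - k)₊`,
which gives (i).

Keeping the dissipation gives smoothing. Since only `L¹` is available, `y₊²` is replaced by a `G` of
linear growth. A companion `g` with `g'² ≤ G''` brings in Sobolev's inequality for `φ g(w)`, and
Hölder's inequality yields `(t - s)³ (∫ (w(t) - 1)₊)³ ≤ C (∫ w(s)₊)⁵` (`exists_mass_gain`). The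
superlinear power drives a De Giorgi iteration over increasing levels and times
(`ae_le_of_mass_le`), hence `|ρ(t)| ≤ C t^(-3/2) ‖ρ₀‖₁`. Interpolation with the `L¹` bound gives
(ii) for all `p`, with one constant. -/

/-! ### Convex truncations of the positive part -/

/-- Precomposition with the positive part preserves differentiability of a function whose
derivative vanishes at the origin. -/
theorem HasDerivAt.comp_posPart {f f' : ℝ → ℝ} (hf : ∀ x, 0 ≤ x → HasDerivAt f (f' x) x)
    (h0 : f' 0 = 0) (x : ℝ) : HasDerivAt (fun y => f (max y 0)) (f' (max x 0)) x := by
  rcases lt_trichotomy x 0 with hx | rfl | hx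
  · rw [max_eq_right hx.le, h0]
    refine (hasDerivAt_const x (f 0)).congr_of_eventuallyEq ?_
    filter_upwards [Iio_mem_nhds hx] with y hy
    rw [max_eq_right (le_of_lt hy)]
  · rw [max_self, h0]
    have h1 : HasDerivWithinAt (fun y => f (max y 0)) 0 (Ici 0) 0 := by
      have := (hf 0 le_rfl).hasDerivWithinAt (s := Ici 0)
      rw [h0] at this
      refine this.congr (fun y hy => ?_) (by simp)
      rw [max_eq_left hy]
    have h2 : HasDerivWithinAt (fun y => f (max y 0)) 0 (Iic 0) 0 := by
      refine (hasDerivWithinAt_const 0 (Iic 0) (f 0)).congr (fun y hy => ?_) (by simp)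
      rw [max_eq_right hy]
    have := h1.union h2
    rwa [Ici_union_Iic, hasDerivWithinAt_univ] at this
  · rw [max_eq_left hx.le]
    refine (hf x hx.le).congr_of_eventuallyEq ?_
    filter_upwards [Ioi_mem_nhds hx] with y hy
    rw [max_eq_left (le_of_lt hy)]

/-- A convex truncation `G` of the positive part, asymptotic to it at infinity, together with a
function `g` satisfying `g'² ≤ G''` that still grows like a power. -/
structure IsTruncationPair (G G' G'' g g' : ℝ → ℝ) : Prop where
  deriv_G : ∀ x, HasDerivAt G (G' x) x
  deriv_G' : ∀ x, HasDerivAt G' (G'' x) x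
  cont_G'' : Continuous G''
  deriv_g : ∀ x, HasDerivAt g (g' x) x
  cont_g' : Continuous g'
  sq_g'_le : ∀ x, g' x ^ 2 ≤ G'' x
  G_nonneg : ∀ x, 0 ≤ G x
  G_le : ∀ x, G x ≤ max x 0
  le_G : ∀ x, max x 0 ≤ G x + 3 * √(1 + max x 0)
  sq_g_le : ∀ x, g x ^ 2 ≤ max x 0

/-- Linear growth of `G` forces `G''` to decay; here it decays like `x^(-3/2)`, so `g` may grow like
`x^(1/4)`. Then `g⁶` grows like `x^(3/2)`, more than the factor `x` needed in the last inequality.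
Near zero `g` is far too flat for a bound on `x³`, hence the shift to `x - 1`. -/
theorem exists_truncationPair : ∃ G G' G'' g g' : ℝ → ℝ, ∃ C : ℝ, 0 < C ∧
    IsTruncationPair G G' G'' g g' ∧ ∀ x, max (x - 1) 0 ^ 3 ≤ C * g x ^ 6 * max x 0 ^ 2 := by
  have hr : ∀ x : ℝ, 0 ≤ x → HasDerivAt (fun y => √(1 + y)) (1 / (2 * √(1 + x))) x := by
    intro x hx
    have := ((hasDerivAt_id x).const_add 1).sqrt (by simp; positivity)
    simpa using this
  have hs : ∀ x : ℝ, 0 ≤ x → HasDerivAt (fun y => √√(1 + y)) (1 / (4 * √√(1 + x) ^ 3)) x := by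
    intro x hx
    have := (hr x hx).sqrt (by positivity)
    convert this using 1
    have h1 : √(1 + x) = √√(1 + x) ^ 2 := (Real.sq_sqrt (by positivity)).symm
    have h2 : 0 < √√(1 + x) := by positivity
    rw [h1]
    simp only [Real.sqrt_sq h2.le]
    field_simp
    ring
  have r1 : ∀ x : ℝ, 0 ≤ x → 1 ≤ √(1 + x) := by
    intro x hx; rw [Real.one_le_sqrt]; linarith
  have s1 : ∀ x : ℝ, 0 ≤ x → 1 ≤ √√(1 + x) := by
    intro x hx; rw [Real.one_le_sqrt]; exact r1 x hx
  have rx : ∀ x : ℝ, 0 ≤ x → √(1 + x) ^ 2 = 1 + x := fun x hx => Real.sq_sqrt (by positivity)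
  have sr : ∀ x : ℝ, 0 ≤ x → √√(1 + x) ^ 2 = √(1 + x) := fun x hx => Real.sq_sqrt (by positivity)
  have sx : ∀ x : ℝ, 0 ≤ x → √√(1 + x) ^ 4 = 1 + x := by
    intro x hx
    calc √√(1 + x) ^ 4 = (√√(1 + x) ^ 2) ^ 2 := by ring
      _ = 1 + x := by rw [sr x hx, rx x hx]
  -- The cube makes `Γ` vanish to third order at zero, so that its extension by zero is `C²`. The
  -- function `γ` is the primitive of `γ'` vanishing at zero.
  set Γ : ℝ → ℝ := fun x => (√(1 + x) - 1) ^ 3 / √(1 + x)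
  set Γ' : ℝ → ℝ := fun x => 1 - 3 / 2 * (√(1 + x))⁻¹ + 1 / 2 * ((√(1 + x)) ^ 3)⁻¹
  set Γ'' : ℝ → ℝ := fun x => 3 / 4 * x * (√(1 + x) ^ 5)⁻¹
  set γ : ℝ → ℝ := fun x => √√(1 + x) + 1 / 3 * (√√(1 + x) ^ 3)⁻¹ - 4 / 3
  set γ' : ℝ → ℝ := fun x => x / (4 * √√(1 + x) ^ 7)
  have hγ : ∀ x : ℝ, 0 ≤ x →
      γ x = (√√(1 + x) - 1) ^ 2 * (3 * √√(1 + x) ^ 2 + 2 * √√(1 + x) + 1) / (3 * √√(1 + x) ^ 3) := by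
    intro x hx
    have := s1 x hx
    simp only [γ]
    field_simp
    ring
  have hγ0 : ∀ x : ℝ, 0 ≤ x → 0 ≤ γ x := by
    intro x hx
    rw [hγ x hx]
    positivity
  refine ⟨fun x => Γ (max x 0), fun x => Γ' (max x 0), fun x => Γ'' (max x 0),
    fun x => γ (max x 0), fun x => γ' (max x 0), 50 ^ 6, by norm_num, ⟨?_, ?_, ?_, ?_, ?_, ?_,
    ?_, ?_, ?_, ?_⟩, ?_⟩
  · refine HasDerivAt.comp_posPart (fun x hx => ?_) (by simp [Γ']; norm_num)
    have h := r1 x hx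
    have hr' := hr x hx
    have := (((hr'.sub_const 1).fun_pow 3)).fun_div hr' (by positivity)
    refine this.congr_deriv ?_
    simp only [Γ']
    field_simp
    ring
  · refine HasDerivAt.comp_posPart (fun x hx => ?_) (by simp [Γ''])
    have h := r1 x hx
    have hr' := hr x hx
    have := (((hr'.fun_inv (by positivity)).const_mul (3 / 2)).const_sub 1).fun_add
      (((hr'.fun_pow 3).fun_inv (by positivity)).const_mul (1 / 2))
    refine this.congr_deriv ?_
    have e := rx x hx
    simp only [Γ'']
    field_simp
    rw [show x = √(1 + x) ^ 2 - 1 by linarith]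
    simp only [add_sub_cancel, Real.sqrt_sq (zero_le_one.trans h)]
    ring
  · have : ∀ x : ℝ, √(1 + max x 0) ^ 5 ≠ 0 := fun x => by positivity
    simp only [Γ'']
    fun_prop (disch := assumption)
  · refine HasDerivAt.comp_posPart (fun x hx => ?_) (by simp [γ'])
    have h := s1 x hx
    have hs' := hs x hx
    have := (hs'.fun_add (((hs'.fun_pow 3).fun_inv (by positivity)).const_mul (1 / 3))).sub_const
      (4 / 3)
    refine this.congr_deriv ?_
    have e := sx x hx
    simp only [γ']
    have ex : x = √√(1 + x) ^ 4 - 1 := by linarith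
    set s := √√(1 + x)
    rw [ex]
    field_simp
    ring
  · have : ∀ x : ℝ, 4 * √√(1 + max x 0) ^ 7 ≠ 0 := fun x => by positivity
    simp only [γ']
    fun_prop (disch := assumption)
  · intro y
    have hx : 0 ≤ max y 0 := le_max_right _ _
    generalize max y 0 = x at hx
    simp only [γ', Γ'']
    have h := s1 x hx
    have e := sx x hx
    have e' := sr x hx
    generalize √√(1 + x) = s at *
    rw [← e']
    have : (x / (4 * s ^ 7)) ^ 2 = x ^ 2 / (16 * s ^ 14) := by field_simp; norm_num
    rw [this, ← div_eq_mul_inv, div_le_div_iff₀ (by positivity) (by positivity)]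
    have e2 : x * s ^ 10 ≤ s ^ 14 := by
      rw [show s ^ 14 = s ^ 4 * s ^ 10 by ring, e]
      gcongr; linarith
    have e3 : 0 ≤ x * s ^ 14 := by positivity
    calc x ^ 2 * (s ^ 2) ^ 5 = x * (x * s ^ 10) := by ring
      _ ≤ x * s ^ 14 := by gcongr
      _ ≤ _ := by linarith
  · intro y
    have h := r1 (max y 0) (le_max_right _ _)
    have : 0 ≤ √(1 + max y 0) - 1 := by linarith
    simp only [Γ]
    positivity
  · intro y
    have hx : 0 ≤ max y 0 := le_max_right _ _
    generalize max y 0 = x at hx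
    have h := r1 x hx
    have e := rx x hx
    simp only [Γ]
    rw [div_le_iff₀ (by positivity)]
    rw [show x = √(1 + x) ^ 2 - 1 by linarith]
    simp only [add_sub_cancel, Real.sqrt_sq (zero_le_one.trans h)]
    generalize √(1 + x) = r at h
    nlinarith [mul_nonneg (sub_nonneg.2 h) (sub_nonneg.2 h), mul_nonneg (sub_nonneg.2 h) (zero_le_one.trans h)]
  · intro y
    have hx : 0 ≤ max y 0 := le_max_right _ _
    generalize max y 0 = x at hx
    have h := r1 x hx
    have e := rx x hx
    simp only [Γ]
    rw [← sub_le_iff_le_add, le_div_iff₀ (by positivity)]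
    rw [show x = √(1 + x) ^ 2 - 1 by linarith]
    simp only [add_sub_cancel, Real.sqrt_sq (zero_le_one.trans h)]
    generalize √(1 + x) = r at h
    nlinarith
  · intro y
    have hx : 0 ≤ max y 0 := le_max_right _ _
    generalize max y 0 = x at hx
    have h := s1 x hx
    have e := sx x hx
    have h0 := hγ0 x hx
    have h1 : γ x ≤ √√(1 + x) - 1 := by
      simp only [γ]
      have : (√√(1 + x) ^ 3)⁻¹ ≤ 1 := inv_le_one_of_one_le₀ (one_le_pow₀ h)
      linarith
    calc γ x ^ 2 ≤ (√√(1 + x) - 1) ^ 2 := by gcongr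
      _ ≤ √√(1 + x) ^ 4 - 1 := by
        generalize √√(1 + x) = s at h
        have : 0 ≤ (s - 1) * (s ^ 3 + s ^ 2 + 2) := by
          have : 0 ≤ s - 1 := by linarith
          positivity
        nlinarith
      _ = x := by linarith
  · intro y
    have hm := hγ0 _ (le_max_right y 0)
    beta_reduce
    rcases le_total y 1 with hy | hy
    · rw [max_eq_right (by linarith : y - 1 ≤ 0), zero_pow three_ne_zero]
      positivity
    · rw [max_eq_left (by linarith : 0 ≤ y - 1), max_eq_left (by linarith : (0 : ℝ) ≤ y)]
      have hx : 0 ≤ y := by linarith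
      have h := s1 y hx
      have e := sx y hx
      have hg : √√(1 + y) / 50 ≤ γ y := by
        rw [hγ y hx]
        have h2 : (2 : ℝ) ≤ √√(1 + y) ^ 4 := by linarith
        -- A rational number slightly below `2^(1/4)`, still large enough to give `s - 1 ≥ 0.15 s`;
        -- since `3 · 0.15² · 50 > 3`, the constant `50` suffices.
        have h3 : 6 / 5 * (1 - 1 / 70) ≤ √√(1 + y) := by
          by_contra hc
          push Not at hc
          have : √√(1 + y) ^ 4 < (6 / 5 * (1 - 1 / 70)) ^ 4 := by gcongr
          norm_num at this
          linarith
        generalize √√(1 + y) = s at h h2 h3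
        rw [div_le_div_iff₀ (by norm_num) (by positivity)]
        have h4 : 0.15 * s ≤ s - 1 := by norm_num at h3 ⊢; linarith
        have h5 : (0.15 * s) ^ 2 ≤ (s - 1) ^ 2 := by gcongr
        calc s * (3 * s ^ 3) ≤ (0.15 * s) ^ 2 * (3 * s ^ 2) * 50 := by
              have : 0 ≤ s ^ 4 := by positivity
              nlinarith
          _ ≤ (s - 1) ^ 2 * (3 * s ^ 2 + 2 * s + 1) * 50 := by
              gcongr
              nlinarith
      have h6 : y ≤ 50 ^ 6 * γ y ^ 6 := by
        calc y ≤ √√(1 + y) ^ 4 := by linarith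
          _ ≤ √√(1 + y) ^ 6 := pow_le_pow_right₀ h (by norm_num)
          _ = 50 ^ 6 * (√√(1 + y) / 50) ^ 6 := by ring
          _ ≤ _ := by gcongr
      calc (y - 1) ^ 3 ≤ y ^ 3 := by gcongr; linarith
        _ = y * y ^ 2 := by ring
        _ ≤ _ := by gcongr

/-! ### Coordinates and integration by parts in space -/

/-- The `i`-th standard unit vector of `ℝ³`. -/
noncomputable abbrev unitVec (i : Fin 3) : R3 := EuclideanSpace.single i 1

theorem sum_coord_smul_unitVec (y : R3) : ∑ i, y i • unitVec i = y := by
  have := (EuclideanSpace.basisFun (Fin 3) ℝ).sum_repr y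
  simpa using this

theorem ContinuousLinearMap.apply_eq_sum_unitVec (L : R3 →L[ℝ] ℝ) (y : R3) :
    L y = ∑ i, y i * L (unitVec i) := by
  conv_lhs => rw [← sum_coord_smul_unitVec y]
  simp [map_sum]

theorem ContinuousLinearMap.sq_norm_le_sum_unitVec (L : R3 →L[ℝ] ℝ) :
    ‖L‖ ^ 2 ≤ ∑ i, L (unitVec i) ^ 2 := by
  have h : ‖L‖ ≤ √(∑ i, L (unitVec i) ^ 2) := by
    refine L.opNorm_le_bound (by positivity) fun y => ?_
    rw [L.apply_eq_sum_unitVec y, EuclideanSpace.norm_eq, Real.norm_eq_abs, ← Real.sqrt_sq_eq_abs,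
      ← Real.sqrt_mul (by positivity)]
    apply Real.sqrt_le_sqrt
    have := Finset.sum_mul_sq_le_sq_mul_sq Finset.univ (fun i => y i) (fun i => L (unitVec i))
    simp only [Real.norm_eq_abs, sq_abs]
    linarith
  calc ‖L‖ ^ 2 ≤ √(∑ i, L (unitVec i) ^ 2) ^ 2 := by gcongr
    _ = _ := Real.sq_sqrt (by positivity)

theorem ContDiff.fderiv_apply_const {f : R3 → ℝ} {m n : WithTop ℕ∞} (hf : ContDiff ℝ n f)
    (hmn : m + 1 ≤ n) (e : R3) : ContDiff ℝ m (fun y => fderiv ℝ f y e) :=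
  (hf.fderiv_right hmn).clm_apply contDiff_const

theorem laplacian_eq_sum_fderiv {f : R3 → ℝ} (hf : ContDiff ℝ 2 f) (x : R3) :
    (Δ f) x = ∑ i, fderiv ℝ (fun y => fderiv ℝ f y (unitVec i)) x (unitVec i) := by
  rw [InnerProductSpace.laplacian_eq_iteratedFDeriv_orthonormalBasis f
    (EuclideanSpace.basisFun (Fin 3) ℝ)]
  refine Finset.sum_congr rfl fun i _ => ?_
  have hd : DifferentiableAt ℝ (fderiv ℝ f) x :=
    (hf.fderiv_right (m := 1) (by norm_num)).differentiable (by norm_num) x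
  rw [iteratedFDeriv_two_apply, fderiv_clm_apply hd (differentiableAt_const _)]
  simp

theorem continuous_laplacian {f : R3 → ℝ} (hf : ContDiff ℝ 2 f) : Continuous (Δ f) := by
  rw [funext (laplacian_eq_sum_fderiv hf)]
  refine continuous_finsetSum _ fun i _ => ?_
  exact ((hf.fderiv_apply_const (m := 1) (by norm_num) _).fderiv_apply_const
    (m := 0) (by norm_num) _).continuous

theorem integral_mul_fderiv_eq_neg {f g : R3 → ℝ} (hf : ContDiff ℝ 1 f) (hg : ContDiff ℝ 1 g)
    (hc : HasCompactSupport f) (e : R3) :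
    ∫ x, f x * fderiv ℝ g x e = -∫ x, fderiv ℝ f x e * g x := by
  have hf' := (hf.fderiv_apply_const (m := 0) (by norm_num) e).continuous
  have hg' := (hg.fderiv_apply_const (m := 0) (by norm_num) e).continuous
  refine integral_mul_fderiv_eq_neg_fderiv_mul_of_integrable ?_ ?_ ?_
    (fun x _ => hf.differentiable (by norm_num) x) (fun x _ => hg.differentiable (by norm_num) x)
  · exact (hf'.mul hg.continuous).integrable_of_hasCompactSupport (hc.fderiv_apply ℝ e).mul_right
  · exact (hf.continuous.mul hg').integrable_of_hasCompactSupport hc.mul_right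
  · exact (hf.continuous.mul hg.continuous).integrable_of_hasCompactSupport hc.mul_right

/-- Integration by parts for the transport term of a divergence-free field. -/
theorem integral_mul_fderiv_divergence_free {φ b : R3 → ℝ} {u : R3 → R3} (hφ : ContDiff ℝ 1 φ)
    (hc : HasCompactSupport φ) (hb : ContDiff ℝ 1 b) (hu : ContDiff ℝ 1 u)
    (hdiv : ∀ x, divergence u x = 0) :
    ∫ x, φ x * fderiv ℝ b x (u x) = -∫ x, b x * fderiv ℝ φ x (u x) := by
  have hui : ∀ i, ContDiff ℝ 1 (fun x => u x i) := fun i => (contDiff_euclidean.1 hu) i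
  have hφu : ∀ i, ContDiff ℝ 1 (fun x => φ x * u x i) := fun i => hφ.mul (hui i)
  have hcu : ∀ i, HasCompactSupport (fun x => φ x * u x i) := fun i => hc.mul_right
  have h1 : ∀ x, φ x * fderiv ℝ b x (u x)
      = ∑ i, (φ x * u x i) * fderiv ℝ b x (unitVec i) := by
    intro x
    rw [(fderiv ℝ b x).apply_eq_sum_unitVec (u x), Finset.mul_sum]
    exact Finset.sum_congr rfl fun i _ => by ring
  have hd : ∀ i x, fderiv ℝ (fun x => φ x * u x i) x (unitVec i)
      = φ x * (fderiv ℝ u x (unitVec i)) i + u x i * fderiv ℝ φ x (unitVec i) := by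
    intro i x
    rw [fderiv_fun_mul (hφ.differentiable (by norm_num) x) ((hui i).differentiable (by norm_num) x)]
    have : fderiv ℝ (fun x => u x i) x (unitVec i) = (fderiv ℝ u x (unitVec i)) i := by
      have h : HasFDerivAt (fun x => u x i) _ x := (EuclideanSpace.proj (𝕜 := ℝ) i).hasFDerivAt.comp
        x (hu.differentiable (by norm_num) x).hasFDerivAt
      rw [h.fderiv]
      rfl
    simp [this]
  have h2 : ∀ x, b x * fderiv ℝ φ x (u x)
      = ∑ i, fderiv ℝ (fun x => φ x * u x i) x (unitVec i) * b x := by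
    intro x
    simp_rw [hd, ← Finset.sum_mul, Finset.sum_add_distrib, ← Finset.mul_sum]
    rw [(fderiv ℝ φ x).apply_eq_sum_unitVec (u x)]
    have := hdiv x
    rw [divergence] at this
    rw [this]
    ring
  have hb' := fun e => (hb.fderiv_apply_const (m := 0) (by norm_num) e).continuous
  have hφ' := fun i => ((hφu i).fderiv_apply_const (m := 0) (by norm_num) (unitVec i)).continuous
  simp_rw [h1, h2]
  rw [integral_finsetSum, integral_finsetSum, ← Finset.sum_neg_distrib]
  · exact Finset.sum_congr rfl fun i _ => integral_mul_fderiv_eq_neg (hφu i) hb (hcu i) _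
  · intro i _
    exact ((hφ' i).mul hb.continuous).integrable_of_hasCompactSupport
      ((hcu i).fderiv_apply ℝ _).mul_right
  · intro i _
    exact ((hφu i).continuous.mul (hb' _)).integrable_of_hasCompactSupport (hcu i).mul_right

/-- Integration by parts for the diffusion term, tested with `φ β'(w)`. -/
theorem integral_mul_laplacian_comp {φ w : R3 → ℝ} {β β' β'' : ℝ → ℝ} (hφ : ContDiff ℝ 2 φ)
    (hc : HasCompactSupport φ) (hw : ContDiff ℝ 2 w) (hβ : ∀ y, HasDerivAt β (β' y) y)
    (hβ' : ∀ y, HasDerivAt β' (β'' y) y) (hβ'' : Continuous β'') :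
    ∫ x, φ x * (β' (w x) * (Δ w) x) = (∫ x, β (w x) * (Δ φ) x)
      - ∫ x, φ x * (β'' (w x) * ∑ i, fderiv ℝ w x (unitVec i) ^ 2) := by
  have cβ' : ContDiff ℝ 1 β' := by
    rw [contDiff_one_iff_deriv]
    refine ⟨fun y => (hβ' y).differentiableAt, ?_⟩
    rwa [show deriv β' = β'' from funext fun y => (hβ' y).deriv]
  have cβ : ContDiff ℝ 1 β := by
    rw [contDiff_one_iff_deriv]
    refine ⟨fun y => (hβ y).differentiableAt, ?_⟩
    rw [show deriv β = β' from funext fun y => (hβ y).deriv]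
    exact cβ'.continuous
  have hw1 : ContDiff ℝ 1 w := hw.of_le (by norm_num)
  have hφ1 : ContDiff ℝ 1 φ := hφ.of_le (by norm_num)
  have dw : ∀ x, HasFDerivAt w (fderiv ℝ w x) x := fun x =>
    (hw1.differentiable (by norm_num) x).hasFDerivAt
  have dφ : ∀ x, HasFDerivAt φ (fderiv ℝ φ x) x := fun x =>
    (hφ1.differentiable (by norm_num) x).hasFDerivAt
  have hwi : ∀ i, ContDiff ℝ 1 (fun x => fderiv ℝ w x (unitVec i)) := fun i =>
    hw.fderiv_apply_const (by norm_num) _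
  have hφi : ∀ i, ContDiff ℝ 1 (fun x => fderiv ℝ φ x (unitVec i)) := fun i =>
    hφ.fderiv_apply_const (by norm_num) _
  have hφi_c : ∀ i, HasCompactSupport (fun x => fderiv ℝ φ x (unitVec i)) := fun i =>
    hc.fderiv_apply ℝ _
  have hb : ContDiff ℝ 1 (fun x => β (w x)) := cβ.comp hw1
  have hb' : ContDiff ℝ 1 (fun x => β' (w x)) := cβ'.comp hw1
  have h1 : ∀ i, ∫ x, (φ x * β' (w x)) * fderiv ℝ (fun y => fderiv ℝ w y (unitVec i)) x (unitVec i)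
      = (∫ x, fderiv ℝ (fun y => fderiv ℝ φ y (unitVec i)) x (unitVec i) * β (w x))
        - ∫ x, φ x * (β'' (w x) * fderiv ℝ w x (unitVec i) ^ 2) := by
    intro i
    rw [integral_mul_fderiv_eq_neg (hφ1.mul hb') (hwi i) hc.mul_right]
    have e2 := integral_mul_fderiv_eq_neg (hφi i) hb (hφi_c i) (unitVec i)
    have e3 : ∀ x, fderiv ℝ (fun x => β (w x)) x (unitVec i)
        = β' (w x) * fderiv ℝ w x (unitVec i) := by
      intro x
      have h : HasFDerivAt (fun x => β (w x)) _ x := (hβ (w x)).comp_hasFDerivAt x (dw x)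
      rw [h.fderiv]
      simp
    have e4 : ∀ x, fderiv ℝ (fun x => φ x * β' (w x)) x (unitVec i) * fderiv ℝ w x (unitVec i)
        = fderiv ℝ φ x (unitVec i) * fderiv ℝ (fun x => β (w x)) x (unitVec i)
          + φ x * (β'' (w x) * fderiv ℝ w x (unitVec i) ^ 2) := by
      intro x
      have h : HasFDerivAt (fun x => β' (w x)) _ x := (hβ' (w x)).comp_hasFDerivAt x (dw x)
      rw [((dφ x).fun_mul h).fderiv, e3]
      simp
      ring
    simp_rw [e4]
    rw [integral_add, e2]
    · ring
    · exact ((hφi i).continuous.mul (hb.fderiv_apply_const (m := 0) (by norm_num) _).continuous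
        ).integrable_of_hasCompactSupport (hφi_c i).mul_right
    · exact (hφ.continuous.mul ((hβ''.comp hw.continuous).mul ((hwi i).continuous.pow 2))
        ).integrable_of_hasCompactSupport hc.mul_right
  have l1 : ∀ x, φ x * (β' (w x) * (Δ w) x) = ∑ i, (φ x * β' (w x)) *
      fderiv ℝ (fun y => fderiv ℝ w y (unitVec i)) x (unitVec i) := by
    intro x
    rw [laplacian_eq_sum_fderiv hw, ← Finset.mul_sum]
    ring
  have l2 : ∀ x, β (w x) * (Δ φ) x = ∑ i,
      fderiv ℝ (fun y => fderiv ℝ φ y (unitVec i)) x (unitVec i) * β (w x) := by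
    intro x
    rw [laplacian_eq_sum_fderiv hφ, ← Finset.sum_mul]
    ring
  have l3 : ∀ x, φ x * (β'' (w x) * ∑ i, fderiv ℝ w x (unitVec i) ^ 2) = ∑ i,
      φ x * (β'' (w x) * fderiv ℝ w x (unitVec i) ^ 2) := by
    intro x
    simp_rw [Finset.mul_sum]
  simp_rw [l1, l2, l3]
  rw [integral_finsetSum, integral_finsetSum, integral_finsetSum, ← Finset.sum_sub_distrib]
  · exact Finset.sum_congr rfl fun i _ => h1 i
  · intro i _
    exact (hφ.continuous.mul ((hβ''.comp hw.continuous).mul ((hwi i).continuous.pow 2))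
        ).integrable_of_hasCompactSupport hc.mul_right
  · intro i _
    exact (((hφi i).fderiv_apply_const (m := 0) (by norm_num) _).continuous.mul hb.continuous
      ).integrable_of_hasCompactSupport ((hφi_c i).fderiv_apply ℝ _).mul_right
  · intro i _
    exact ((hφ.continuous.mul hb'.continuous).mul ((hwi i).fderiv_apply_const (m := 0)
      (by norm_num) _).continuous).integrable_of_hasCompactSupport hc.mul_right.mul_right

/-! ### Solutions with small tails and the local energy identity -/

/-- A classical solution on `(0,T) × ℝ³` whose positive part is integrable in space, with tails
that are small locally uniformly in time. -/
structure IsTailSolution (T : ℝ) (v : ℝ → R3 → R3) (w : ℝ → R3 → ℝ) : Prop where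
  smooth : ContDiffOn ℝ ∞ (fun q : ℝ × R3 => w q.1 q.2) (Ioo 0 T ×ˢ univ)
  eqn : ∀ t ∈ Ioo 0 T, ∀ x,
    deriv (fun s => w s x) t + fderiv ℝ (w t) x (v t x) - (Δ (w t)) x = 0
  integrable : ∀ t ∈ Ioo 0 T, Integrable (fun x => max (w t x) 0)
  tail : ∀ a ∈ Ioo 0 T, ∀ b ∈ Ioo 0 T, ∀ ε > 0, ∃ R₀ : ℝ, ∀ R ≥ R₀, ∀ t ∈ Icc a b,
    ∫ x in {x | R ≤ ‖x‖}, max (w t x) 0 ≤ ε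

theorem contDiff_slice {F : Type*} [NormedAddCommGroup F] [NormedSpace ℝ F] {T : ℝ}
    {w : ℝ → R3 → F}
    (hw : ContDiffOn ℝ ∞ (fun q : ℝ × R3 => w q.1 q.2) (Ioo 0 T ×ˢ univ)) {t : ℝ}
    (ht : t ∈ Ioo 0 T) : ContDiff ℝ ∞ (w t) := by
  rw [← contDiffOn_univ]
  exact hw.comp (g := fun q : ℝ × R3 => w q.1 q.2) (f := fun x => (t, x)) (s := univ)
    (contDiff_const.prodMk contDiff_id).contDiffOn fun x _ => ⟨ht, mem_univ _⟩

theorem hasDerivAt_time {T : ℝ} {w : ℝ → R3 → ℝ}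
    (hw : ContDiffOn ℝ ∞ (fun q : ℝ × R3 => w q.1 q.2) (Ioo 0 T ×ˢ univ)) {t : ℝ}
    (ht : t ∈ Ioo 0 T) (x : R3) :
    HasDerivAt (fun s => w s x) (fderiv ℝ (fun q : ℝ × R3 => w q.1 q.2) (t, x) (1, 0)) t := by
  have hU : IsOpen (Ioo 0 T ×ˢ (univ : Set R3)) := isOpen_Ioo.prod isOpen_univ
  have h := (hw.contDiffAt (hU.mem_nhds (mk_mem_prod ht (mem_univ x)))).differentiableAt
    (by norm_num)
  exact h.hasFDerivAt.comp_hasDerivAt t ((hasDerivAt_id t).prodMk (hasDerivAt_const t x))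

theorem continuousOn_deriv_time {T : ℝ} {w : ℝ → R3 → ℝ}
    (hw : ContDiffOn ℝ ∞ (fun q : ℝ × R3 => w q.1 q.2) (Ioo 0 T ×ˢ univ)) :
    ContinuousOn (fun q : ℝ × R3 => deriv (fun s => w s q.2) q.1) (Ioo 0 T ×ˢ univ) := by
  have hU : IsOpen (Ioo 0 T ×ˢ (univ : Set R3)) := isOpen_Ioo.prod isOpen_univ
  refine ((hw.continuousOn_fderiv_of_isOpen hU (by norm_num)).clm_apply
    (continuousOn_const (c := ((1 : ℝ), (0 : R3))))).congr fun q hq => ?_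
  exact (hasDerivAt_time hw hq.1 q.2).deriv

/-- Differentiation in time under a compactly supported space integral. -/
theorem hasDerivAt_integral_mul_comp {T : ℝ} {w : ℝ → R3 → ℝ} {φ : R3 → ℝ} {β β' : ℝ → ℝ}
    (hw : ContDiffOn ℝ ∞ (fun q : ℝ × R3 => w q.1 q.2) (Ioo 0 T ×ˢ univ))
    (hφ : Continuous φ) (hc : HasCompactSupport φ) (hβ : ∀ y, HasDerivAt β (β' y) y)
    (hβ' : Continuous β') {t : ℝ} (ht : t ∈ Ioo 0 T) :
    HasDerivAt (fun τ => ∫ x, φ x * β (w τ x))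
      (∫ x, φ x * (β' (w t x) * deriv (fun s => w s x) t)) t := by
  have cβ : Continuous β := continuous_iff_continuousAt.2 fun y => (hβ y).continuousAt
  obtain ⟨r, hr, hrT⟩ := Metric.nhds_basis_closedBall.mem_iff.1 (isOpen_Ioo.mem_nhds ht)
  have hF' : ContinuousOn
      (fun q : ℝ × R3 => φ q.2 * (β' (w q.1 q.2) * deriv (fun s => w s q.2) q.1))
      (Ioo 0 T ×ˢ univ) :=
    (hφ.comp continuous_snd).continuousOn.mul
      ((hβ'.comp_continuousOn hw.continuousOn).mul (continuousOn_deriv_time hw))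
  obtain ⟨M, hM⟩ := ((isCompact_closedBall t r).prod hc.isCompact).exists_bound_of_continuousOn
    (hF'.mono (prod_mono hrT (subset_univ (tsupport φ))))
  have hslice : ∀ τ ∈ Ioo 0 T, Continuous (w τ) := fun τ hτ => (contDiff_slice hw hτ).continuous
  refine (hasDerivAt_integral_of_dominated_loc_of_deriv_le
    (bound := (tsupport φ).indicator fun _ => M)
    (F' := fun τ x => φ x * (β' (w τ x) * deriv (fun s => w s x) τ))
    (Metric.closedBall_mem_nhds t hr) ?_ ?_ ?_ ?_ ?_ ?_).2
  · filter_upwards [isOpen_Ioo.mem_nhds ht] with τ hτ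
    exact (hφ.mul (cβ.comp (hslice τ hτ))).aestronglyMeasurable
  · exact (hφ.mul (cβ.comp (hslice t ht))).integrable_of_hasCompactSupport hc.mul_right
  · have : Continuous fun x => φ x * (β' (w t x) * deriv (fun s => w s x) t) := by
      rw [← continuousOn_univ]
      exact hF'.comp (f := fun x => (t, x)) (by fun_prop) fun x _ => ⟨ht, mem_univ _⟩
    exact this.aestronglyMeasurable
  · refine Eventually.of_forall fun x τ hτ => ?_
    by_cases hx : x ∈ tsupport φ
    · rw [indicator_of_mem hx]
      exact hM (τ, x) ⟨hτ, hx⟩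
    · rw [indicator_of_notMem hx, image_eq_zero_of_notMem_tsupport hx]
      simp
  · rw [integrable_indicator_iff (isClosed_tsupport φ).measurableSet]
    exact integrableOn_const hc.isCompact.measure_lt_top.ne
  · refine Eventually.of_forall fun x τ hτ => ?_
    have h := hasDerivAt_time hw (hrT hτ) x
    have h2 := ((hβ (w τ x)).comp τ h).const_mul (φ x)
    rwa [← h.deriv] at h2

/-- The local energy identity for a convex function `β` of the solution. -/
theorem hasDerivAt_integral_energy {T : ℝ} {v : ℝ → R3 → R3} {w : ℝ → R3 → ℝ} {φ : R3 → ℝ}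
    {β β' β'' : ℝ → ℝ} (hv : IsVelocityField T v) (hw : IsTailSolution T v w)
    (hφ : ContDiff ℝ 2 φ) (hc : HasCompactSupport φ) (hβ : ∀ y, HasDerivAt β (β' y) y)
    (hβ' : ∀ y, HasDerivAt β' (β'' y) y) (hβ'' : Continuous β'') {t : ℝ} (ht : t ∈ Ioo 0 T) :
    HasDerivAt (fun τ => ∫ x, φ x * β (w τ x))
      ((∫ x, β (w t x) * (fderiv ℝ φ x (v t x) + (Δ φ) x))
        - ∫ x, φ x * (β'' (w t x) * ∑ i, fderiv ℝ (w t) x (unitVec i) ^ 2)) t := by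
  have cβ' : Continuous β' := continuous_iff_continuousAt.2 fun y => (hβ' y).continuousAt
  have h := hasDerivAt_integral_mul_comp hw.smooth hφ.continuous hc hβ cβ' ht
  refine h.congr_deriv ?_
  have sw := contDiff_slice hw.smooth ht
  have sw2 : ContDiff ℝ 2 (w t) := sw.of_le (mod_cast ENat.LEInfty.out)
  have sw1 : ContDiff ℝ 1 (w t) := sw.of_le (by exact_mod_cast le_top)
  have sv := contDiff_slice hv.smooth ht
  have sv1 : ContDiff ℝ 1 (v t) := sv.of_le (by exact_mod_cast le_top)
  have hφ1 : ContDiff ℝ 1 φ := hφ.of_le (by norm_num)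
  have cβ1 : ContDiff ℝ 1 β := by
    rw [contDiff_one_iff_deriv]
    refine ⟨fun y => (hβ y).differentiableAt, ?_⟩
    rwa [show deriv β = β' from funext fun y => (hβ y).deriv]
  have hb : ContDiff ℝ 1 (fun x => β (w t x)) := cβ1.comp sw1
  have hDb : ∀ x, fderiv ℝ (fun x => β (w t x)) x (v t x)
      = β' (w t x) * fderiv ℝ (w t) x (v t x) := by
    intro x
    have h : HasFDerivAt (fun x => β (w t x)) _ x := (hβ (w t x)).comp_hasFDerivAt x
      (sw1.differentiable (by norm_num) x).hasFDerivAt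
    rw [h.fderiv]
    simp
  have e : ∀ x, φ x * (β' (w t x) * deriv (fun s => w s x) t)
      = φ x * (β' (w t x) * (Δ (w t)) x) - φ x * fderiv ℝ (fun x => β (w t x)) x (v t x) := by
    intro x
    have := hw.eqn t ht x
    rw [show deriv (fun s => w s x) t = (Δ (w t)) x - fderiv ℝ (w t) x (v t x) by linarith, hDb]
    ring
  have cDφ : Continuous fun x => fderiv ℝ φ x (v t x) :=
    (hφ1.continuous_fderiv (by norm_num)).clm_apply sv.continuous
  have e2 : ∀ x, β (w t x) * (fderiv ℝ φ x (v t x) + (Δ φ) x)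
      = β (w t x) * (Δ φ) x + β (w t x) * fderiv ℝ φ x (v t x) := fun x => by ring
  have cΔ : HasCompactSupport (Δ φ) := by
    refine hc.mono' ?_
    rw [Function.support_subset_iff']
    intro x hx
    have : φ =ᶠ[𝓝 x] fun _ => 0 := notMem_tsupport_iff_eventuallyEq.1 hx
    rw [(InnerProductSpace.laplacian_congr_nhds this).self_of_nhds]
    simp
  have cD : HasCompactSupport fun x => fderiv ℝ φ x (v t x) := by
    refine (hc.fderiv ℝ).mono fun x hx => ?_
    contrapose! hx
    simp only [Function.mem_support, not_not] at hx ⊢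
    rw [hx]
    simp
  simp_rw [e, e2]
  rw [integral_sub, integral_mul_laplacian_comp hφ hc sw2 hβ hβ' hβ'',
    integral_mul_fderiv_divergence_free hφ1 hc hb sv1 (hv.div_free t ht), integral_add]
  · ring
  · exact (hb.continuous.mul (continuous_laplacian hφ)).integrable_of_hasCompactSupport cΔ.mul_left
  · exact (hb.continuous.mul cDφ).integrable_of_hasCompactSupport cD.mul_left
  · exact (hφ.continuous.mul ((cβ'.comp sw.continuous).mul (continuous_laplacian sw2))
      ).integrable_of_hasCompactSupport hc.mul_right
  · exact (hφ.continuous.mul ((hb.continuous_fderiv (by norm_num)).clm_apply sv.continuous)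
      ).integrable_of_hasCompactSupport hc.mul_right

/-! ### Cutoffs and the error they cause -/

/-- A smooth cutoff at scale `R`. -/
structure IsCutoff (C R : ℝ) (φ : R3 → ℝ) : Prop where
  smooth : ContDiff ℝ 2 φ
  compact : HasCompactSupport φ
  nonneg : ∀ x, 0 ≤ φ x
  le_one : ∀ x, φ x ≤ 1
  eq_one : ∀ x, ‖x‖ < R → φ x = 1
  norm_fderiv_le : ∀ x, ‖fderiv ℝ φ x‖ ≤ C / R
  abs_laplacian_le : ∀ x, |(Δ φ) x| ≤ C / R ^ 2
  fderiv_eq_zero : ∀ x, 2 * R < ‖x‖ → fderiv ℝ φ x = 0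

theorem IsCutoff.eventuallyEq_one {C R : ℝ} {φ : R3 → ℝ} (h : IsCutoff C R φ) {x : R3}
    (hx : ‖x‖ < R) : φ =ᶠ[𝓝 x] fun _ => 1 := by
  filter_upwards [(isOpen_lt continuous_norm continuous_const).mem_nhds hx] with y hy
  exact h.eq_one y hy

theorem IsCutoff.fderiv_eq_zero_of_lt {C R : ℝ} {φ : R3 → ℝ} (h : IsCutoff C R φ) {x : R3}
    (hx : ‖x‖ < R) : fderiv ℝ φ x = 0 := by
  rw [(h.eventuallyEq_one hx).fderiv_eq]
  simp

theorem IsCutoff.laplacian_eq_zero_of_lt {C R : ℝ} {φ : R3 → ℝ} (h : IsCutoff C R φ) {x : R3}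
    (hx : ‖x‖ < R) : (Δ φ) x = 0 := by
  rw [(InnerProductSpace.laplacian_congr_nhds (h.eventuallyEq_one hx)).self_of_nhds]
  simp

/-- A single bump is dilated by `R`: each derivative costs a factor `1 / R`, so one constant serves
all scales. -/
theorem exists_cutoff : ∃ C : ℝ, 0 ≤ C ∧ ∀ R : ℝ, 0 < R → ∃ φ, IsCutoff C R φ := by
  let χ : ContDiffBump (0 : R3) := ⟨1, 2, one_pos, one_lt_two⟩
  have hχ : ContDiff ℝ 2 χ := χ.contDiff
  have hc : HasCompactSupport χ := χ.hasCompactSupport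
  have cD : Continuous (fderiv ℝ χ) := hχ.continuous_fderiv (by norm_num)
  have cΔ : HasCompactSupport (Δ (χ : R3 → ℝ)) := by
    refine hc.mono' ?_
    rw [Function.support_subset_iff']
    intro x hx
    have : (χ : R3 → ℝ) =ᶠ[𝓝 x] fun _ => 0 := notMem_tsupport_iff_eventuallyEq.1 hx
    rw [(InnerProductSpace.laplacian_congr_nhds this).self_of_nhds]
    simp
  obtain ⟨C₁, hC₁⟩ := (hc.fderiv ℝ).exists_bound_of_continuous cD
  obtain ⟨C₂, hC₂⟩ := cΔ.exists_bound_of_continuous (continuous_laplacian hχ)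
  refine ⟨max C₁ C₂, (norm_nonneg _).trans ((hC₁ 0).trans (le_max_left _ _)), fun R hR => ?_⟩
  have hscale : Continuous fun x : R3 => R⁻¹ • x := by fun_prop
  have hs : ContDiff ℝ 2 fun x => χ (R⁻¹ • x) := hχ.comp (contDiff_const_smul R⁻¹)
  have hf : ∀ {f : R3 → ℝ}, Differentiable ℝ f → ∀ x,
      fderiv ℝ (fun y => f (R⁻¹ • y)) x = R⁻¹ • fderiv ℝ f (R⁻¹ • x) := by
    intro f hf x
    have h1 : HasFDerivAt (fun y : R3 => R⁻¹ • y) (R⁻¹ • ContinuousLinearMap.id ℝ R3) x :=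
      (hasFDerivAt_id x).const_smul R⁻¹
    have h2 : HasFDerivAt (fun y => f (R⁻¹ • y)) _ x := (hf (R⁻¹ • x)).hasFDerivAt.comp x h1
    rw [h2.fderiv]
    ext y
    simp
  have hD := hf (hχ.differentiable (by norm_num))
  have hx : ∀ x : R3, ‖R⁻¹ • x‖ = ‖x‖ / R := fun x => by
    rw [norm_smul, Real.norm_of_nonneg (by positivity)]; ring
  have hcut : ∀ x : R3, 2 * R ≤ ‖x‖ → χ (R⁻¹ • x) = 0 := by
    intro x hx'
    apply χ.zero_of_le_dist
    rw [dist_zero_right, hx]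
    exact (le_div_iff₀ hR).2 hx'
  refine ⟨fun x => χ (R⁻¹ • x), hs, ?_, fun x => χ.nonneg, fun x => χ.le_one, ?_, ?_, ?_, ?_⟩
  · refine HasCompactSupport.intro (isCompact_closedBall (0 : R3) (2 * R)) fun x hx' => ?_
    apply hcut
    simp only [Metric.mem_closedBall, dist_zero_right, not_le] at hx'
    exact hx'.le
  · intro x hx'
    apply χ.one_of_mem_closedBall
    rw [mem_closedBall_zero_iff, hx]
    exact (div_le_one hR).2 hx'.le
  · intro x
    rw [hD, norm_smul, Real.norm_of_nonneg (by positivity), inv_mul_eq_div]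
    gcongr
    exact (hC₁ _).trans (le_max_left _ _)
  · intro x
    have e : (Δ fun x => χ (R⁻¹ • x)) x = R⁻¹ ^ 2 * (Δ (χ : R3 → ℝ)) (R⁻¹ • x) := by
      rw [laplacian_eq_sum_fderiv hs, laplacian_eq_sum_fderiv hχ, Finset.mul_sum]
      refine Finset.sum_congr rfl fun i _ => ?_
      simp_rw [hD]
      have hd : Differentiable ℝ fun y => fderiv ℝ χ y (unitVec i) :=
        (hχ.fderiv_apply_const (m := 1) (by norm_num) _).differentiable (by norm_num)
      have h3 : (fun y => (R⁻¹ • fderiv ℝ χ (R⁻¹ • y)) (unitVec i))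
          = fun y => R⁻¹ * fderiv ℝ χ (R⁻¹ • y) (unitVec i) := by
        ext y; simp
      have h4 : DifferentiableAt ℝ (fun y => fderiv ℝ χ (R⁻¹ • y) (unitVec i)) x :=
        (hd (R⁻¹ • x)).comp x (by fun_prop)
      rw [h3, fderiv_const_mul h4, hf hd]
      simp
      ring
    rw [e, abs_mul, abs_of_nonneg (by positivity), inv_pow, inv_mul_eq_div]
    gcongr
    exact (hC₂ _).trans (le_max_right _ _)
  · intro x hx'
    have : (fun x => χ (R⁻¹ • x)) =ᶠ[𝓝 x] fun _ => 0 := by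
      filter_upwards [(isOpen_lt continuous_const continuous_norm).mem_nhds hx'] with y hy
      exact hcut y (le_of_lt hy)
    rw [this.fderiv_eq]
    simp

/-- The error caused by a cutoff is bounded and lives far out. -/
theorem exists_cutoff_error_bound {T : ℝ} {v : ℝ → R3 → R3} (hv : IsVelocityField T v) {a b : ℝ}
    (ha : a ∈ Ioo 0 T) (hb : b ∈ Ioo 0 T) {C : ℝ} (hC : 0 ≤ C) : ∃ B : ℝ, 0 ≤ B ∧
      ∀ R : ℝ, 1 ≤ R → ∀ φ, IsCutoff C R φ → ∀ t ∈ Icc a b, ∀ x,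
        fderiv ℝ φ x (v t x) + (Δ φ) x ≤ {x | R ≤ ‖x‖}.indicator (fun _ => B) x := by
  obtain ⟨K, hK⟩ := hv.growth a ha b hb
  refine ⟨C * (3 * |K|) + C, by positivity, fun R hR φ hφ t ht x => ?_⟩
  by_cases hx : R ≤ ‖x‖
  · rw [indicator_of_mem (by exact hx)]
    have h1 : fderiv ℝ φ x (v t x) ≤ C * (3 * |K|) := by
      -- The gradient lives where `‖x‖ ≤ 2 * R`. There `1 + ‖x‖ ≤ 3 * R` because `1 ≤ R`, and the
      -- growth of the field cancels the factor `1 / R`.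
      by_cases h2 : 2 * R < ‖x‖
      · rw [hφ.fderiv_eq_zero x h2]
        simp
        positivity
      · push Not at h2
        calc fderiv ℝ φ x (v t x) ≤ ‖fderiv ℝ φ x (v t x)‖ := Real.le_norm_self _
          _ ≤ ‖fderiv ℝ φ x‖ * ‖v t x‖ := ContinuousLinearMap.le_opNorm _ _
          _ ≤ C / R * (|K| * (3 * R)) := by
            gcongr
            · exact hφ.norm_fderiv_le x
            · refine (hK t ht x).trans ?_
              gcongr
              · exact le_abs_self K
              · linarith
          _ = C * (3 * |K|) := by field_simp
    have h3 : (Δ φ) x ≤ C := by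
      refine (le_abs_self _).trans ((hφ.abs_laplacian_le x).trans ?_)
      exact div_le_self hC (one_le_pow₀ hR)
    linarith
  · rw [indicator_of_notMem (by exact hx)]
    push Not at hx
    rw [hφ.fderiv_eq_zero_of_lt hx, hφ.laplacian_eq_zero_of_lt hx]
    simp

/-! ### Sobolev and Hölder inequalities -/

/-- The Sobolev inequality `Ḣ¹ ⊂ L⁶` in terms of integrals. -/
theorem exists_sobolev_six : ∃ C : ℝ, 0 < C ∧ ∀ u : R3 → ℝ, ContDiff ℝ 1 u → HasCompactSupport u →
    ∫ x, u x ^ 6 ≤ C * (∫ x, ‖fderiv ℝ u x‖ ^ 2) ^ 3 := by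
  set S := SNormLESNormFDerivOfEqConst ℝ (volume : Measure R3) 2
  refine ⟨(S : ℝ) ^ 6 + 1, by positivity, fun u hu hc => ?_⟩
  have h := eLpNorm_le_eLpNorm_fderiv_of_eq (volume : Measure R3) hu hc (p := 2) (p' := 6)
    (by norm_num) (by simp) (by simp; norm_num)
  have cu := hu.continuous
  have cD := hu.continuous_fderiv (by norm_num)
  have m6 : MemLp u 6 := cu.memLp_of_hasCompactSupport hc
  have m2 : MemLp (fderiv ℝ u) 2 := cD.memLp_of_hasCompactSupport (hc.fderiv ℝ)
  simp only [ENNReal.coe_ofNat] at h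
  rw [m6.eLpNorm_eq_integral_rpow_norm (by norm_num) (by norm_num),
    m2.eLpNorm_eq_integral_rpow_norm (by norm_num) (by norm_num)] at h
  have h' := ENNReal.toReal_mono (by finiteness) h
  rw [ENNReal.toReal_mul, ENNReal.toReal_ofReal (by positivity),
    ENNReal.toReal_ofReal (by positivity), ENNReal.coe_toReal] at h'
  simp only [ENNReal.toReal_ofNat] at h'
  have e6 : ∀ x, ‖u x‖ ^ (6 : ℝ) = u x ^ 6 := by
    intro x
    rw [show (6 : ℝ) = ((6 : ℕ) : ℝ) by norm_num, Real.rpow_natCast, Real.norm_eq_abs]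
    exact Even.pow_abs (by decide) _
  have e2 : ∀ x, ‖fderiv ℝ u x‖ ^ (2 : ℝ) = ‖fderiv ℝ u x‖ ^ 2 := fun x => by
    rw [show (2 : ℝ) = ((2 : ℕ) : ℝ) by norm_num, Real.rpow_natCast]
  simp_rw [e6, e2] at h'
  have i6 : 0 ≤ ∫ x, u x ^ 6 := integral_nonneg fun x => by positivity
  have i2 : 0 ≤ ∫ x, ‖fderiv ℝ u x‖ ^ 2 := integral_nonneg fun x => by positivity
  have h6 := pow_le_pow_left₀ (by positivity) h' 6
  rw [mul_pow, ← Real.rpow_natCast, ← Real.rpow_mul i6, ← Real.rpow_natCast (_ ^ (2 : ℝ)⁻¹),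
    ← Real.rpow_mul i2] at h6
  norm_num at h6
  calc ∫ x, u x ^ 6 ≤ _ := h6
    _ ≤ _ := by
      gcongr
      linarith

/-- A form of Hölder's inequality with exponents `3` and `3/2`. -/
theorem integral_pow_three_le {α : Type*} [MeasurableSpace α] {μ : Measure α} {f p q : α → ℝ}
    (hf : ∀ x, 0 ≤ f x) (hp : ∀ x, 0 ≤ p x) (hq : ∀ x, 0 ≤ q x) (ip : Integrable p μ)
    (iq : Integrable q μ) (h : ∀ x, f x ^ 3 ≤ p x * q x ^ 2) :
    (∫ x, f x ∂μ) ^ 3 ≤ (∫ x, p x ∂μ) * (∫ x, q x ∂μ) ^ 2 := by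
  have h3 : ∀ x, (p x ^ (1 / 3 : ℝ)) ^ (3 : ℝ) = p x := fun x => by
    rw [← Real.rpow_mul (hp x)]; norm_num
  have h32 : ∀ x, (q x ^ (2 / 3 : ℝ)) ^ (3 / 2 : ℝ) = q x := fun x => by
    rw [← Real.rpow_mul (hq x)]; norm_num
  have hm : ∀ {r : ℝ} {k : α → ℝ}, 0 < r → (∀ x, 0 ≤ k x) → AEStronglyMeasurable k μ →
      Integrable (fun x => k x ^ r) μ → MemLp k (ENNReal.ofReal r) μ := by
    intro r k hr hk mk hi
    rw [← integrable_norm_rpow_iff mk (by simpa using hr) (by simp)]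
    rw [ENNReal.toReal_ofReal hr.le]
    refine hi.congr (Eventually.of_forall fun x => ?_)
    simp only [Real.norm_of_nonneg (hk x)]
  have mp : MemLp (fun x => p x ^ (1 / 3 : ℝ)) (ENNReal.ofReal 3) μ := by
    refine hm (by norm_num) (fun x => Real.rpow_nonneg (hp x) _) ?_ ?_
    · exact (ip.aemeasurable.pow_const _).aestronglyMeasurable
    · simpa only [h3] using ip
  have mq : MemLp (fun x => q x ^ (2 / 3 : ℝ)) (ENNReal.ofReal (3 / 2)) μ := by
    refine hm (by norm_num) (fun x => Real.rpow_nonneg (hq x) _) ?_ ?_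
    · exact (iq.aemeasurable.pow_const _).aestronglyMeasurable
    · simpa only [h32] using iq
  have hpq : (3 : ℝ).HolderConjugate (3 / 2) := by
    rw [Real.holderConjugate_iff]; norm_num
  have key := integral_mul_le_Lp_mul_Lq_of_nonneg hpq
    (Eventually.of_forall fun x => Real.rpow_nonneg (hp x) _)
    (Eventually.of_forall fun x => Real.rpow_nonneg (hq x) _) mp mq
  have : (ENNReal.ofReal 3).HolderConjugate (ENNReal.ofReal (3 / 2)) := hpq.ennrealOfReal
  have hi : Integrable (fun x => p x ^ (1 / 3 : ℝ) * q x ^ (2 / 3 : ℝ)) μ := by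
    exact mp.integrable_mul mq
  simp only [h3, h32] at key
  have hle : ∫ x, f x ∂μ ≤ ∫ x, p x ^ (1 / 3 : ℝ) * q x ^ (2 / 3 : ℝ) ∂μ := by
    refine integral_mono_of_nonneg (Eventually.of_forall hf) hi (Eventually.of_forall fun x => ?_)
    have hr : 0 ≤ p x ^ (1 / 3 : ℝ) * q x ^ (2 / 3 : ℝ) :=
      mul_nonneg (Real.rpow_nonneg (hp x) _) (Real.rpow_nonneg (hq x) _)
    refine le_of_pow_le_pow_left₀ three_ne_zero hr ((h x).trans_eq ?_)
    rw [mul_pow, ← Real.rpow_natCast (_ ^ (1 / 3 : ℝ)), ← Real.rpow_natCast (_ ^ (2 / 3 : ℝ)),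
      ← Real.rpow_mul (hp x), ← Real.rpow_mul (hq x)]
    norm_num
  have Ip : 0 ≤ ∫ x, p x ∂μ := integral_nonneg hp
  have Iq : 0 ≤ ∫ x, q x ∂μ := integral_nonneg hq
  calc (∫ x, f x ∂μ) ^ 3 ≤ _ := pow_le_pow_left₀ (integral_nonneg hf) (hle.trans key) 3
    _ = _ := by
      rw [mul_pow, ← Real.rpow_natCast, ← Real.rpow_mul Ip, ← Real.rpow_natCast (_ ^ (1 / (3 / 2) : ℝ)),
        ← Real.rpow_mul Iq]
      norm_num

/-! ### Energy inequality and monotonicity of the mass -/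

namespace IsTailSolution

variable {T : ℝ} {v : ℝ → R3 → R3} {w : ℝ → R3 → ℝ}

theorem continuous_slice (hw : IsTailSolution T v w) {t : ℝ} (ht : t ∈ Ioo 0 T) :
    Continuous (w t) := (contDiff_slice hw.smooth ht).continuous

/-- An affine change of the unknown. -/
theorem affine (hw : IsTailSolution T v w) {c δ : ℝ} (hc : 0 ≤ c) (hδ : 0 < δ) :
    IsTailSolution T v fun t x => (w t x - c) / δ := by
  have hle : ∀ y : ℝ, max ((y - c) / δ) 0 ≤ δ⁻¹ * max y 0 := by
    intro y
    have : 0 ≤ max y 0 := le_max_right _ _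
    refine max_le ?_ (by positivity)
    rw [div_eq_inv_mul]
    gcongr
    exact (sub_le_self _ hc).trans (le_max_left _ _)
  have hint : ∀ t ∈ Ioo 0 T, Integrable (fun x => max ((w t x - c) / δ) 0) := by
    intro t ht
    refine ((hw.integrable t ht).const_mul δ⁻¹).mono' ?_ (Eventually.of_forall fun x => ?_)
    · have := hw.continuous_slice ht
      exact Continuous.aestronglyMeasurable (by fun_prop)
    · rw [Real.norm_of_nonneg (le_max_right _ _)]
      exact hle _
  refine ⟨(hw.smooth.sub contDiffOn_const).div_const δ, fun t ht x => ?_, hint,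
    fun a ha b hb ε hε => ?_⟩
  · have sw : ContDiff ℝ 2 (w t) := (contDiff_slice hw.smooth ht).of_le (mod_cast ENat.LEInfty.out)
    have e := hw.eqn t ht x
    have hd := (hasDerivAt_time hw.smooth ht x).differentiableAt
    have hx : DifferentiableAt ℝ (w t) x := sw.differentiable (by norm_num) x
    have e1 : deriv (fun s => (w s x - c) / δ) t = deriv (fun s => w s x) t / δ := by
      rw [deriv_div_const, deriv_sub_const]
    have e2 : ∀ y, fderiv ℝ (fun x => (w t x - c) / δ) y = δ⁻¹ • fderiv ℝ (w t) y := by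
      intro y
      have hy : HasFDerivAt (w t) (fderiv ℝ (w t) y) y :=
        (sw.differentiable (by norm_num) y).hasFDerivAt
      have := (hy.sub_const c).const_mul δ⁻¹
      simp_rw [div_eq_inv_mul]
      exact this.fderiv
    have sw' : ContDiff ℝ 2 fun x => (w t x - c) / δ := (sw.sub contDiff_const).div_const δ
    have e3 : (Δ fun x => (w t x - c) / δ) x = δ⁻¹ * (Δ (w t)) x := by
      rw [laplacian_eq_sum_fderiv sw', laplacian_eq_sum_fderiv sw, Finset.mul_sum]
      refine Finset.sum_congr rfl fun i _ => ?_
      simp_rw [e2]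
      have hd : DifferentiableAt ℝ (fun y => fderiv ℝ (w t) y (unitVec i)) x :=
        (sw.fderiv_apply_const (m := 1) (by norm_num) _).differentiable (by norm_num) x
      simp only [_root_.smul_apply, smul_eq_mul]
      rw [fderiv_const_mul hd]
      simp
    rw [e1, e2, e3]
    simp only [_root_.smul_apply, smul_eq_mul]
    rw [div_eq_inv_mul, ← mul_add, ← mul_sub, e, mul_zero]
  · obtain ⟨R₀, h⟩ := hw.tail a ha b hb (ε * δ) (by positivity)
    refine ⟨R₀, fun R hR t ht => ?_⟩
    have htT : t ∈ Ioo 0 T := ⟨ha.1.trans_le ht.1, ht.2.trans_lt hb.2⟩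
    calc ∫ x in {x | R ≤ ‖x‖}, max ((w t x - c) / δ) 0
        ≤ ∫ x in {x | R ≤ ‖x‖}, δ⁻¹ * max (w t x) 0 :=
          integral_mono (hint t htT).integrableOn
            ((hw.integrable t htT).const_mul δ⁻¹).integrableOn fun x => hle _
      _ = δ⁻¹ * ∫ x in {x | R ≤ ‖x‖}, max (w t x) 0 := integral_const_mul _ _
      _ ≤ δ⁻¹ * (ε * δ) := by gcongr; exact h R hR t ht
      _ = ε := by field_simp

/-- The cutoff equals one inside the ball of radius `R`, and outside it `f` is dominated by `k`,
whose tail is small. This passes from localised integrals to global ones; the power `n` is there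
because the Sobolev step produces `φ ^ 2`. -/
theorem integral_le_integral_cutoff_add {f k φ : R3 → ℝ} {C R ε : ℝ} (hφ : IsCutoff C R φ)
    {n : ℕ} (hf : Integrable f) (hf0 : ∀ x, 0 ≤ f x) (hfk : ∀ x, f x ≤ k x) (hk : Integrable k)
    (htail : ∫ x in {x | R ≤ ‖x‖}, k x ≤ ε) :
    ∫ x, f x ≤ (∫ x, φ x ^ n * f x) + ε := by
  have hm : MeasurableSet {x : R3 | R ≤ ‖x‖} := (isClosed_le continuous_const continuous_norm
    ).measurableSet
  have hi : Integrable fun x => φ x ^ n * f x := by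
    refine hf.mono' ((hφ.smooth.continuous.pow n).aestronglyMeasurable.mul hf.1)
      (Eventually.of_forall fun x => ?_)
    rw [norm_mul, Real.norm_of_nonneg (hf0 x), Real.norm_of_nonneg (pow_nonneg (hφ.nonneg x) n)]
    exact mul_le_of_le_one_left (hf0 x) (pow_le_one₀ (hφ.nonneg x) (hφ.le_one x))
  rw [← integral_indicator hm] at htail
  calc ∫ x, f x ≤ ∫ x, φ x ^ n * f x + {x | R ≤ ‖x‖}.indicator k x := by
        refine integral_mono hf (hi.add (hk.indicator hm)) fun x => ?_
        by_cases hx : R ≤ ‖x‖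
        · rw [indicator_of_mem (by exact hx)]
          have : 0 ≤ φ x ^ n * f x := mul_nonneg (pow_nonneg (hφ.nonneg x) n) (hf0 x)
          have := hfk x
          linarith
        · rw [indicator_of_notMem (by exact hx)]
          push Not at hx
          simp [hφ.eq_one x hx]
    _ ≤ _ := by
        rw [integral_add hi (hk.indicator hm)]
        gcongr

variable {G G' G'' g g' : ℝ → ℝ}

theorem _root_.IsTruncationPair.continuous_G (h : IsTruncationPair G G' G'' g g') :
    Continuous G := continuous_iff_continuousAt.2 fun y => (h.deriv_G y).continuousAt

theorem integrable_G (hw : IsTailSolution T v w) (h : IsTruncationPair G G' G'' g g') {t : ℝ}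
    (ht : t ∈ Ioo 0 T) : Integrable fun x => G (w t x) := by
  refine (hw.integrable t ht).mono'
    (h.continuous_G.comp (hw.continuous_slice ht)).aestronglyMeasurable
    (Eventually.of_forall fun x => ?_)
  rw [Real.norm_of_nonneg (h.G_nonneg _)]
  exact h.G_le _

theorem cutoff_integral_G_le (hw : IsTailSolution T v w) (h : IsTruncationPair G G' G'' g g')
    {C R : ℝ} {φ : R3 → ℝ} (hφ : IsCutoff C R φ) {t : ℝ} (ht : t ∈ Ioo 0 T) :
    ∫ x, φ x * G (w t x) ≤ ∫ x, G (w t x) := by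
  refine integral_mono_of_nonneg (Eventually.of_forall fun x =>
    mul_nonneg (hφ.nonneg x) (h.G_nonneg _)) (hw.integrable_G h ht)
    (Eventually.of_forall fun x => ?_)
  exact mul_le_of_le_one_left (h.G_nonneg _) (hφ.le_one x)

/-- The localised dissipation of the truncated energy. -/
noncomputable def _root_.dissipation (φ w : R3 → ℝ) (G'' : ℝ → ℝ) : ℝ :=
  ∫ x, φ x * (G'' (w x) * ∑ i, fderiv ℝ w x (unitVec i) ^ 2)

/-- The localised truncated energy decreases at the rate given by the dissipation, up to a small
multiple of the time elapsed. -/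
theorem cutoff_energy_le (hv : IsVelocityField T v) (hw : IsTailSolution T v w)
    (h : IsTruncationPair G G' G'' g g') {s t : ℝ} (hs : s ∈ Ioo 0 T) (ht : t ∈ Ioo 0 T)
    (hst : s ≤ t) {C : ℝ} (hC : 0 ≤ C) {ε : ℝ} (hε : 0 < ε) : ∃ R₀ : ℝ, ∀ R ≥ R₀, ∀ φ,
      IsCutoff C R φ → ∀ κ : ℝ, (∀ τ ∈ Icc s t, κ ≤ dissipation φ (w τ) G'') →
        ∫ x, φ x * G (w t x) ≤ (∫ x, φ x * G (w s x)) + (ε - κ) * (t - s) := by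
  obtain ⟨B, hB, hBφ⟩ := exists_cutoff_error_bound hv hs ht hC
  -- The cutoff error is at most `B` times the tail mass; `B + 1` avoids a division by zero.
  obtain ⟨R₀, hR₀⟩ := hw.tail s hs t ht (ε / (B + 1)) (by positivity)
  refine ⟨max R₀ 1, fun R hR φ hφ κ hκ => ?_⟩
  have hR1 : 1 ≤ R := (le_max_right _ _).trans hR
  have hT : ∀ τ ∈ Icc s t, τ ∈ Ioo 0 T := fun τ hτ => ⟨hs.1.trans_le hτ.1, hτ.2.trans_lt ht.2⟩
  have hder := fun τ hτ => hasDerivAt_integral_energy hv hw hφ.smooth hφ.compact h.deriv_G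
    h.deriv_G' h.cont_G'' (hT τ hτ)
  have hm : MeasurableSet {x : R3 | R ≤ ‖x‖} := (isClosed_le continuous_const continuous_norm
    ).measurableSet
  have hbd : ∀ τ ∈ Icc s t, ∫ x, G (w τ x) * (fderiv ℝ φ x (v τ x) + (Δ φ) x) ≤ ε := by
    intro τ hτ
    have hi : Integrable ({x : R3 | R ≤ ‖x‖}.indicator fun x => B * max (w τ x) 0) :=
      ((hw.integrable τ (hT τ hτ)).const_mul B).indicator hm
    have hle : ∀ x, G (w τ x) * (fderiv ℝ φ x (v τ x) + (Δ φ) x)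
        ≤ {x : R3 | R ≤ ‖x‖}.indicator (fun x => B * max (w τ x) 0) x := by
      intro x
      have h1 := mul_le_mul_of_nonneg_left (hBφ R hR1 φ hφ τ hτ x) (h.G_nonneg (w τ x))
      refine h1.trans ?_
      by_cases hx : R ≤ ‖x‖
      · rw [indicator_of_mem (by exact hx), indicator_of_mem (by exact hx), mul_comm]
        gcongr
        exact h.G_le _
      · rw [indicator_of_notMem (by exact hx), indicator_of_notMem (by exact hx), mul_zero]
    have hint : ∫ x, G (w τ x) * (fderiv ℝ φ x (v τ x) + (Δ φ) x)
        ≤ ∫ x, {x : R3 | R ≤ ‖x‖}.indicator (fun x => B * max (w τ x) 0) x := by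
      -- No separate proof of integrability is needed: a non-integrable left side has integral `0`
      -- by convention, and the right side is nonnegative.
      by_cases hI : Integrable fun x => G (w τ x) * (fderiv ℝ φ x (v τ x) + (Δ φ) x)
      · exact integral_mono hI hi hle
      · rw [integral_undef hI]
        refine integral_nonneg fun x => indicator_nonneg (fun y _ => ?_) x
        have : 0 ≤ max (w τ y) 0 := le_max_right _ _
        positivity
    refine hint.trans ?_
    rw [integral_indicator hm, integral_const_mul]
    calc B * ∫ x in {x : R3 | R ≤ ‖x‖}, max (w τ x) 0 ≤ B * (ε / (B + 1)) := by
          gcongr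
          exact hR₀ R ((le_max_left _ _).trans hR) τ hτ
      _ ≤ ε := by
          rw [mul_div_assoc', div_le_iff₀ (by positivity)]
          nlinarith
  have hmv := (convex_Icc s t).image_sub_le_mul_sub_of_deriv_le
    (f := fun τ => ∫ x, φ x * G (w τ x)) (C := ε - κ)
    (fun τ hτ => (hder τ hτ).continuousAt.continuousWithinAt)
    (fun τ hτ => (hder τ (interior_subset hτ)).differentiableAt.differentiableWithinAt)
    (fun τ hτ => by
      have hτ := interior_subset hτ
      rw [(hder τ hτ).deriv]
      have h1 := hbd τ hτ
      have h2 := hκ τ hτ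
      rw [dissipation] at h2
      linarith)
    s (left_mem_Icc.2 hst) t (right_mem_Icc.2 hst) hst
  linarith

theorem dissipation_nonneg (h : IsTruncationPair G G' G'' g g') {C R : ℝ} {φ : R3 → ℝ}
    (hφ : IsCutoff C R φ) (u : R3 → ℝ) : 0 ≤ dissipation φ u G'' := by
  refine integral_nonneg fun x => mul_nonneg (hφ.nonneg x) (mul_nonneg ?_ (by positivity))
  exact (sq_nonneg _).trans (h.sq_g'_le _)

/-- The dissipation is nonnegative, so the energy inequality holds with `κ = 0`; the cutoff and tail
errors are made to add up to `ε`. -/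
theorem integral_G_antitone (hv : IsVelocityField T v) (hw : IsTailSolution T v w)
    (h : IsTruncationPair G G' G'' g g') {s t : ℝ} (hs : s ∈ Ioo 0 T) (ht : t ∈ Ioo 0 T)
    (hst : s ≤ t) : ∫ x, G (w t x) ≤ ∫ x, G (w s x) := by
  refine le_of_forall_pos_le_add fun ε hε => ?_
  obtain ⟨C, hC, hcut⟩ := exists_cutoff
  set η := ε / (t - s + 1)
  have hts : 0 ≤ t - s := by linarith
  have hη : 0 < η := by positivity
  obtain ⟨R₀, h₀⟩ := hw.cutoff_energy_le hv h hs ht hst hC hη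
  obtain ⟨R₁, h₁⟩ := hw.tail s hs t ht η hη
  obtain ⟨φ, hφ⟩ := hcut (max (max R₀ R₁) 1) (by positivity)
  have e1 := h₀ _ ((le_max_left _ _).trans (le_max_left _ _)) φ hφ 0
    fun τ _ => dissipation_nonneg h hφ _
  have e2 := integral_le_integral_cutoff_add (n := 1) hφ (hw.integrable_G h ht)
    (fun x => h.G_nonneg _) (fun x => h.G_le _) (hw.integrable t ht)
    (h₁ _ ((le_max_right _ _).trans (le_max_left _ _)) t (right_mem_Icc.2 hst))
  simp only [pow_one] at e2
  have e3 := hw.cutoff_integral_G_le h hφ hs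
  have : η * (t - s) + η = ε := by simp only [η]; field_simp
  linarith

/-- The mass of the positive part is nonincreasing. -/
theorem integral_posPart_antitone (hv : IsVelocityField T v) (hw : IsTailSolution T v w)
    {s t : ℝ} (hs : s ∈ Ioo 0 T) (ht : t ∈ Ioo 0 T) (hst : s ≤ t) :
    ∫ x, max (w t x) 0 ≤ ∫ x, max (w s x) 0 := by
  obtain ⟨G, G', G'', g, g', -, -, h, -⟩ := exists_truncationPair
  -- With `δ = 1 / (n + 1)`, the functional `∫ δ G(w / δ)` decreases in time, since `w / δ` is again
  -- a solution. It tends to `∫ w₊`, because `δ G(w / δ)` lies below `w₊` by at most `3 √(δ² + δ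
  -- w₊)`.
  have hpos : ∀ n : ℕ, (0 : ℝ) < 1 / (n + 1) := fun n => by positivity
  have hmax : ∀ (n : ℕ) (y : ℝ), (1 / ((n : ℝ) + 1)) * max ((y - 0) / (1 / ((n : ℝ) + 1))) 0
      = max y 0 := by
    intro n y
    rw [mul_max_of_nonneg _ _ (hpos n).le, mul_zero, sub_zero, mul_div_cancel₀ _ (hpos n).ne']
  have hlim : Tendsto (fun n : ℕ => ∫ x, 1 / ((n : ℝ) + 1) * G ((w t x - 0) / (1 / (n + 1)))) atTop
      (𝓝 (∫ x, max (w t x) 0)) := by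
    refine tendsto_integral_of_dominated_convergence (fun x => max (w t x) 0) (fun n => ?_)
      (hw.integrable t ht) (fun n => Eventually.of_forall fun x => ?_)
      (Eventually.of_forall fun x => ?_)
    · have := hw.continuous_slice ht
      have := h.continuous_G
      exact Continuous.aestronglyMeasurable (by fun_prop)
    · rw [Real.norm_of_nonneg (mul_nonneg (hpos n).le (h.G_nonneg _)), ← hmax n (w t x)]
      gcongr
      exact h.G_le _
    · have h0 : Tendsto (fun n : ℕ => 1 / ((n : ℝ) + 1)) atTop (𝓝 0) :=
        tendsto_one_div_add_atTop_nhds_zero_nat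
      have hlow : Tendsto (fun n : ℕ => max (w t x) 0 -
          3 * √((1 / ((n : ℝ) + 1)) ^ 2 + (1 / ((n : ℝ) + 1)) * max (w t x) 0)) atTop
          (𝓝 (max (w t x) 0)) := by
        have : Tendsto (fun δ : ℝ => max (w t x) 0 - 3 * √(δ ^ 2 + δ * max (w t x) 0)) (𝓝 0)
            (𝓝 (max (w t x) 0 - 3 * √(0 ^ 2 + 0 * max (w t x) 0))) := by
          apply Continuous.tendsto
          fun_prop
        simp only [zero_mul, ne_eq, OfNat.ofNat_ne_zero, not_false_eq_true, zero_pow, add_zero,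
          Real.sqrt_zero, mul_zero, sub_zero] at this
        exact this.comp h0
      refine tendsto_of_tendsto_of_tendsto_of_le_of_le hlow tendsto_const_nhds (fun n => ?_)
        fun n => ?_
      · have h1 := mul_le_mul_of_nonneg_left (h.le_G ((w t x - 0) / (1 / (n + 1)))) (hpos n).le
        rw [hmax, mul_add] at h1
        have h2 : 1 / ((n : ℝ) + 1) * (3 * √(1 + max ((w t x - 0) / (1 / (n + 1))) 0))
            = 3 * √((1 / ((n : ℝ) + 1)) ^ 2 + (1 / ((n : ℝ) + 1)) * max (w t x) 0) := by
          rw [← hmax n (w t x)]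
          have hδ := (hpos n).le
          generalize 1 / ((n : ℝ) + 1) = δ at hδ ⊢
          generalize max ((w t x - 0) / δ) 0 = m
          rw [show δ ^ 2 + δ * (δ * m) = δ ^ 2 * (1 + m) by ring, Real.sqrt_mul (by positivity),
            Real.sqrt_sq hδ]
          ring
        rw [h2] at h1
        simp only
        linarith
      · simp only
        rw [← hmax n (w t x)]
        exact mul_le_mul_of_nonneg_left (h.G_le _) (hpos n).le
  refine le_of_tendsto hlim (Eventually.of_forall fun n => ?_)
  have hn := hw.affine le_rfl (hpos n)
  rw [integral_const_mul]
  calc _ ≤ 1 / ((n : ℝ) + 1) * ∫ x, G ((w s x - 0) / (1 / (n + 1))) :=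
        mul_le_mul_of_nonneg_left (hn.integral_G_antitone hv h hs ht hst) (hpos n).le
    _ ≤ ∫ x, max (w s x) 0 := by
        rw [← integral_const_mul]
        refine integral_mono ((hn.integrable_G h hs).const_mul _) (hw.integrable s hs) fun x => ?_
        simp only
        rw [← hmax n (w s x)]
        exact mul_le_mul_of_nonneg_left (h.G_le _) (hpos n).le

end IsTailSolution

/-! ### Dissipation and the nonlinear gain of integrability -/

namespace IsTailSolution

variable {T : ℝ} {v : ℝ → R3 → R3} {w : ℝ → R3 → ℝ} {G G' G'' g g' : ℝ → ℝ}

theorem _root_.IsTruncationPair.contDiff_cutoff_mul (h : IsTruncationPair G G' G'' g g') {C R : ℝ}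
    {φ u : R3 → ℝ} (hφ : IsCutoff C R φ) (hu : ContDiff ℝ 1 u) :
    ContDiff ℝ 1 fun x => φ x * g (u x) := by
  have cg : ContDiff ℝ 1 g := by
    rw [contDiff_one_iff_deriv]
    refine ⟨fun y => (h.deriv_g y).differentiableAt, ?_⟩
    rw [show deriv g = g' from funext fun y => (h.deriv_g y).deriv]
    exact h.cont_g'
  exact (hφ.smooth.of_le (by norm_num)).mul (cg.comp hu)

/-- By the product rule, the part with `∇u` is controlled by the dissipation through `g'² ≤ G''` and
`φ² ≤ φ`. The part with `∇φ` needs only the `L¹` mass, through `g² ≤ u₊`, and vanishes as `R → ∞`.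
-/
theorem _root_.IsTruncationPair.integral_sq_norm_fderiv_le (h : IsTruncationPair G G' G'' g g')
    {C R : ℝ} {φ u : R3 → ℝ} (hφ : IsCutoff C R φ) (hu : ContDiff ℝ 1 u)
    (hi : Integrable fun x => max (u x) 0) :
    ∫ x, ‖fderiv ℝ (fun x => φ x * g (u x)) x‖ ^ 2
      ≤ 2 * dissipation φ u G'' + 2 * ((C / R) ^ 2 * ∫ x, max (u x) 0) := by
  have hφ1 : ContDiff ℝ 1 φ := hφ.smooth.of_le (by norm_num)
  have hD : ∀ x, fderiv ℝ (fun x => φ x * g (u x)) x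
      = (φ x * g' (u x)) • fderiv ℝ u x + g (u x) • fderiv ℝ φ x := by
    intro x
    have h1 : HasFDerivAt (fun x => g (u x)) _ x := (h.deriv_g (u x)).comp_hasFDerivAt x
      (hu.differentiable (by norm_num) x).hasFDerivAt
    rw [((hφ1.differentiable (by norm_num) x).hasFDerivAt.fun_mul h1).fderiv, smul_smul]
  have hG'' : ∀ y, 0 ≤ G'' y := fun y => (sq_nonneg _).trans (h.sq_g'_le y)
  have hle : ∀ x, ‖fderiv ℝ (fun x => φ x * g (u x)) x‖ ^ 2
      ≤ 2 * (φ x * (G'' (u x) * ∑ i, fderiv ℝ u x (unitVec i) ^ 2))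
        + 2 * ((C / R) ^ 2 * max (u x) 0) := by
    intro x
    rw [hD]
    set A := (φ x * g' (u x)) • fderiv ℝ u x
    set B := g (u x) • fderiv ℝ φ x
    have hA : ‖A‖ ^ 2 ≤ φ x * (G'' (u x) * ∑ i, fderiv ℝ u x (unitVec i) ^ 2) := by
      have hφ2 : φ x ^ 2 ≤ φ x := by
        rw [sq]; exact mul_le_of_le_one_left (hφ.nonneg x) (hφ.le_one x)
      have := hφ.nonneg x
      have := hG'' (u x)
      calc ‖A‖ ^ 2 = φ x ^ 2 * (g' (u x) ^ 2 * ‖fderiv ℝ u x‖ ^ 2) := by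
            rw [norm_smul, mul_pow, Real.norm_eq_abs, sq_abs]; ring
        _ ≤ _ := by
            gcongr
            · exact h.sq_g'_le _
            · exact (fderiv ℝ u x).sq_norm_le_sum_unitVec
    have hB : ‖B‖ ^ 2 ≤ (C / R) ^ 2 * max (u x) 0 := by
      calc ‖B‖ ^ 2 = ‖fderiv ℝ φ x‖ ^ 2 * g (u x) ^ 2 := by
            rw [norm_smul, mul_pow, Real.norm_eq_abs, sq_abs]; ring
        _ ≤ _ := by
            gcongr
            · exact hφ.norm_fderiv_le x
            · exact h.sq_g_le _
    have hAB : ‖A + B‖ ^ 2 ≤ (‖A‖ + ‖B‖) ^ 2 := by gcongr; exact norm_add_le _ _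
    nlinarith [sq_nonneg (‖A‖ - ‖B‖)]
  have i1 : Integrable fun x => φ x * (G'' (u x) * ∑ i, fderiv ℝ u x (unitVec i) ^ 2) := by
    refine Continuous.integrable_of_hasCompactSupport ?_ hφ.compact.mul_right
    refine hφ.smooth.continuous.mul ((h.cont_G''.comp hu.continuous).mul ?_)
    exact continuous_finsetSum _ fun i _ =>
      (hu.fderiv_apply_const (m := 0) (by norm_num) _).continuous.pow 2
  have i2 : Integrable fun x => ‖fderiv ℝ (fun x => φ x * g (u x)) x‖ ^ 2 := by
    refine Continuous.integrable_of_hasCompactSupport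
      (((h.contDiff_cutoff_mul hφ hu).continuous_fderiv (by norm_num)).norm.pow 2) ?_
    have : HasCompactSupport (fderiv ℝ fun x => φ x * g (u x)) :=
      (HasCompactSupport.mul_right hφ.compact).fderiv ℝ
    exact this.comp_left (g := fun L => ‖L‖ ^ 2) (by simp)
  refine (integral_mono i2 ((i1.const_mul 2).add ((hi.const_mul _).const_mul 2)) hle).trans_eq ?_
  simp only [Pi.add_apply]
  rw [integral_add (i1.const_mul 2) ((hi.const_mul _).const_mul 2), integral_const_mul,
    integral_const_mul, integral_const_mul, dissipation]

theorem _root_.Continuous.integrable_pow_of_hasCompactSupport {f : R3 → ℝ} (hf : Continuous f)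
    (hc : HasCompactSupport f) {n : ℕ} (hn : n ≠ 0) : Integrable fun x => f x ^ n :=
  (hf.pow n).integrable_of_hasCompactSupport (hc.comp_left (g := fun y => y ^ n) (zero_pow hn))

/-- Sobolev and Hölder inequalities for the truncation, at a fixed time. -/
theorem _root_.IsTruncationPair.cutoff_mass_pow_three_le (h : IsTruncationPair G G' G'' g g')
    {C₁ C₂ : ℝ} (hC₁ : 0 ≤ C₁)
    (hg : ∀ x, max (x - 1) 0 ^ 3 ≤ C₁ * g x ^ 6 * max x 0 ^ 2)
    (hsob : ∀ u : R3 → ℝ, ContDiff ℝ 1 u → HasCompactSupport u →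
      ∫ x, u x ^ 6 ≤ C₂ * (∫ x, ‖fderiv ℝ u x‖ ^ 2) ^ 3)
    {C R : ℝ} {φ u : R3 → ℝ} (hφ : IsCutoff C R φ) (hu : ContDiff ℝ 1 u)
    (hi : Integrable fun x => max (u x) 0) :
    (∫ x, φ x ^ 2 * max (u x - 1) 0) ^ 3
      ≤ C₁ * C₂ * (∫ x, ‖fderiv ℝ (fun x => φ x * g (u x)) x‖ ^ 2) ^ 3
        * (∫ x, max (u x) 0) ^ 2 := by
  have su : ContDiff ℝ 1 fun x => φ x * g (u x) := h.contDiff_cutoff_mul hφ hu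
  have cu : HasCompactSupport fun x => φ x * g (u x) := hφ.compact.mul_right
  have hp : Integrable fun x => C₁ * (φ x * g (u x)) ^ 6 :=
    (su.continuous.integrable_pow_of_hasCompactSupport cu (by norm_num)).const_mul C₁
  have hpt : ∀ x, (φ x ^ 2 * max (u x - 1) 0) ^ 3
      ≤ C₁ * (φ x * g (u x)) ^ 6 * max (u x) 0 ^ 2 := by
    intro x
    calc (φ x ^ 2 * max (u x - 1) 0) ^ 3 = φ x ^ 6 * max (u x - 1) 0 ^ 3 := by ring
      _ ≤ φ x ^ 6 * (C₁ * g (u x) ^ 6 * max (u x) 0 ^ 2) :=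
        mul_le_mul_of_nonneg_left (hg _) (pow_nonneg (hφ.nonneg x) 6)
      _ = _ := by ring
  have hp0 : ∀ x, 0 ≤ C₁ * (φ x * g (u x)) ^ 6 := fun x =>
    mul_nonneg hC₁ (by positivity)
  have hhold := integral_pow_three_le (μ := (volume : Measure R3))
    (fun x => mul_nonneg (sq_nonneg (φ x)) (le_max_right (u x - 1) 0)) hp0
    (fun x => le_max_right (u x) 0) hp hi hpt
  refine hhold.trans ?_
  rw [integral_const_mul, mul_assoc C₁ C₂]
  exact mul_le_mul_of_nonneg_right (mul_le_mul_of_nonneg_left (hsob _ su cu) hC₁) (sq_nonneg _)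

/-- Nonlinear gain of integrability: the mass above level `1` at a later time is controlled by a
superlinear power of the mass above level `0`. -/
theorem exists_mass_gain : ∃ C : ℝ, 0 < C ∧ ∀ (T : ℝ) (v : ℝ → R3 → R3) (w : ℝ → R3 → ℝ),
    IsVelocityField T v → IsTailSolution T v w → ∀ s ∈ Ioo 0 T, ∀ t ∈ Ioo 0 T, s ≤ t →
      (t - s) ^ 3 * (∫ x, max (w t x - 1) 0) ^ 3 ≤ C * (∫ x, max (w s x) 0) ^ 5 := by
  obtain ⟨G, G', G'', g, g', C₁, hC₁, h, hg⟩ := exists_truncationPair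
  obtain ⟨C₂, hC₂, hsob⟩ := exists_sobolev_six
  obtain ⟨C, hC, hcut⟩ := exists_cutoff
  refine ⟨8 * (C₁ * C₂), by positivity, fun T v w hv hw s hs t ht hst => ?_⟩
  set U := ∫ x, max (w s x) 0
  set X := ∫ x, max (w t x - 1) 0
  have hU : 0 ≤ U := integral_nonneg fun x => le_max_right _ _
  have hts : 0 ≤ t - s := by linarith
  -- A cube root, so that the cubed Sobolev–Hölder estimate becomes linear in the Dirichlet integral
  -- and can be integrated in time.
  obtain ⟨q, hq, hq3⟩ : ∃ q : ℝ, 0 ≤ q ∧ q ^ 3 = C₁ * C₂ * U ^ 2 :=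
    ⟨(C₁ * C₂ * U ^ 2) ^ (1 / 3 : ℝ), by positivity, by
      rw [← Real.rpow_natCast, ← Real.rpow_mul (by positivity)]; norm_num⟩
  have hw1 : IsTailSolution T v fun t x => w t x - 1 := by
    simpa using hw.affine (c := 1) zero_le_one one_pos
  have hT : ∀ τ ∈ Icc s t, τ ∈ Ioo 0 T := fun τ hτ => ⟨hs.1.trans_le hτ.1, hτ.2.trans_lt ht.2⟩
  -- Of the `3 * ε`, one comes from the tail of the mass above level `1`, and two from the gradient
  -- of the cutoff.
  have main : ∀ ε > 0, (X - 3 * ε) / 2 * (t - s) ≤ q * U + q * (ε * (t - s)) := by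
    intro ε hε
    obtain ⟨R₀, h₀⟩ := hw.cutoff_energy_le hv h hs ht hst hC hε
    obtain ⟨R₁, h₁⟩ := hw1.tail s hs t ht ε hε
    obtain ⟨R₂, h₂⟩ : ∃ R₂ : ℝ, ∀ R ≥ R₂, q * ((C / R) ^ 2 * U) ≤ ε := by
      have : Tendsto (fun R : ℝ => q * ((C / R) ^ 2 * U)) atTop (𝓝 (q * (0 ^ 2 * U))) :=
        (((tendsto_id.const_div_atTop C).pow 2).mul_const U).const_mul q
      simp only [ne_eq, OfNat.ofNat_ne_zero, not_false_eq_true, zero_pow, zero_mul,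
        mul_zero] at this
      exact eventually_atTop.1 (this.eventually_le_const hε)
    set R := max (max R₀ R₁) (max R₂ 1)
    have hR0 : R₀ ≤ R := (le_max_left _ _).trans (le_max_left _ _)
    have hR1 : R₁ ≤ R := (le_max_right _ _).trans (le_max_left _ _)
    have hR2 : R₂ ≤ R := (le_max_left _ _).trans (le_max_right _ _)
    have hR : 0 < R := zero_lt_one.trans_le ((le_max_right _ _).trans (le_max_right _ _))
    obtain ⟨φ, hφ⟩ := hcut R hR
    have hdiss : ∀ τ ∈ Icc s t, (X - 3 * ε) / 2 ≤ q * dissipation φ (w τ) G'' := by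
      intro τ hτ
      have hτT := hT τ hτ
      have sw : ContDiff ℝ 1 (w τ) :=
        (contDiff_slice hw.smooth hτT).of_le (mod_cast le_top)
      -- Monotonicity at levels `0` and `1` makes the dissipation bound uniform in `τ`: the lower
      -- mass is compared with its value at `s`, the upper mass with its value at `t`.
      have hUτ : ∫ x, max (w τ x) 0 ≤ U := hw.integral_posPart_antitone hv hs hτT hτ.1
      have hXτ : X ≤ ∫ x, max (w τ x - 1) 0 := hw1.integral_posPart_antitone hv hτT ht hτ.2
      set D := ∫ x, ‖fderiv ℝ (fun x => φ x * g (w τ x)) x‖ ^ 2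
      have hD0 : 0 ≤ D := integral_nonneg fun x => by positivity
      have hD : D ≤ _ := h.integral_sq_norm_fderiv_le hφ sw (hw.integrable τ hτT)
      have hloc : X ≤ (∫ x, φ x ^ 2 * max (w τ x - 1) 0) + ε :=
        hXτ.trans (integral_le_integral_cutoff_add (n := 2) hφ (hw1.integrable τ hτT)
          (fun x => le_max_right _ _) (fun x => le_rfl) (hw1.integrable τ hτT) (h₁ R hR1 τ hτ))
      have hcube : (∫ x, φ x ^ 2 * max (w τ x - 1) 0) ^ 3 ≤ (q * D) ^ 3 := by
        have hUτ0 : 0 ≤ ∫ x, max (w τ x) 0 := integral_nonneg fun x => le_max_right _ _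
        refine (h.cutoff_mass_pow_three_le hC₁.le hg hsob hφ sw (hw.integrable τ hτT)).trans ?_
        rw [mul_pow, hq3]
        calc C₁ * C₂ * D ^ 3 * (∫ x, max (w τ x) 0) ^ 2 ≤ C₁ * C₂ * D ^ 3 * U ^ 2 := by gcongr
          _ = _ := by ring
      have hle : ∫ x, φ x ^ 2 * max (w τ x - 1) 0 ≤ q * D :=
        le_of_pow_le_pow_left₀ three_ne_zero (by positivity) hcube
      have h3 : q * D ≤ q * (2 * dissipation φ (w τ) G'' + 2 * ((C / R) ^ 2 * U)) := by
        refine mul_le_mul_of_nonneg_left (hD.trans ?_) hq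
        gcongr
      have h4 := h₂ R hR2
      linarith
    have hU' : ∫ x, φ x * G (w s x) ≤ U := (hw.cutoff_integral_G_le h hφ hs).trans
      (integral_mono (hw.integrable_G h hs) (hw.integrable s hs) fun x => h.G_le _)
    have h0 : 0 ≤ ∫ x, φ x * G (w t x) := integral_nonneg fun x =>
      mul_nonneg (hφ.nonneg x) (h.G_nonneg _)
    -- The dissipation rate `κ` is obtained by dividing by `q`, so `q = 0` is treated apart.
    rcases hq.eq_or_lt with hq0 | hq0
    · have := hdiss s (left_mem_Icc.2 hst)
      rw [← hq0, zero_mul] at this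
      rw [← hq0, zero_mul, zero_mul, add_zero]
      exact mul_nonpos_of_nonpos_of_nonneg this hts
    · have := h₀ R hR0 φ hφ ((X - 3 * ε) / 2 / q) fun τ hτ => by
        rw [div_le_iff₀' hq0]; exact hdiss τ hτ
      have h5 : (X - 3 * ε) / 2 / q * (t - s) ≤ U + ε * (t - s) := by linarith
      have h6 := mul_le_mul_of_nonneg_left h5 hq
      calc (X - 3 * ε) / 2 * (t - s) = q * ((X - 3 * ε) / 2 / q * (t - s)) := by field_simp
        _ ≤ _ := h6
        _ = _ := by ring
  have hlim : X / 2 * (t - s) ≤ q * U := by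
    have h1 : Tendsto (fun ε : ℝ => q * U + q * (ε * (t - s)) - (X - 3 * ε) / 2 * (t - s)) (𝓝[>] 0)
        (𝓝 (q * U + q * (0 * (t - s)) - (X - 3 * 0) / 2 * (t - s))) := by
      refine Tendsto.mono_left (Continuous.tendsto ?_ 0) nhdsWithin_le_nhds
      fun_prop
    have h2 := ge_of_tendsto h1 (b := 0) (by
      filter_upwards [self_mem_nhdsWithin] with ε hε
      have := main ε hε
      linarith)
    linarith
  have hX : 0 ≤ X := integral_nonneg fun x => le_max_right _ _
  calc (t - s) ^ 3 * X ^ 3 = 8 * (X / 2 * (t - s)) ^ 3 := by ring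
    _ ≤ 8 * (q * U) ^ 3 := by gcongr
    _ = 8 * (q ^ 3 * U ^ 3) := by ring
    _ = _ := by rw [hq3]; ring

end IsTailSolution

/-! ### De Giorgi iteration -/

namespace IsTailSolution

variable {T : ℝ} {v : ℝ → R3 → R3} {w : ℝ → R3 → ℝ}

theorem shift (hw : IsTailSolution T v w) {c : ℝ} (hc : 0 ≤ c) :
    IsTailSolution T v fun t x => w t x - c := by
  simpa using hw.affine hc one_pos

/-- De Giorgi iteration: a bounded mass becomes a pointwise bound. -/
theorem ae_le_of_mass_le {C : ℝ} (hC : 0 < C)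
    (hgain : ∀ (T : ℝ) (v : ℝ → R3 → R3) (w : ℝ → R3 → ℝ),
      IsVelocityField T v → IsTailSolution T v w → ∀ s ∈ Ioo 0 T, ∀ t ∈ Ioo 0 T, s ≤ t →
        (t - s) ^ 3 * (∫ x, max (w t x - 1) 0) ^ 3 ≤ C * (∫ x, max (w s x) 0) ^ 5)
    (hv : IsVelocityField T v) (hw : IsTailSolution T v w) {s t m K : ℝ} (hs : s ∈ Ioo 0 T)
    (ht : t ∈ Ioo 0 T) (hst : s ≤ t) (hm : 0 < m) (hsm : ∫ x, max (w s x) 0 ≤ m) (hK : 0 < K)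
    (hKm : 16384 * C * m ^ 2 ≤ K ^ 2 * (t - s) ^ 3) : ∀ᵐ x, w t x ≤ K := by
  have hts : 0 ≤ t - s := by linarith
  have hU0 : ∀ h τ, 0 ≤ ∫ x, max (w τ x - h) 0 := fun h τ =>
    integral_nonneg fun x => le_max_right _ _
  -- The gain is applied to `(w - h) / δ`. Both masses scale by `δ⁻¹`, so the powers `3` and `5`
  -- leave the factor `δ ^ 2`.
  have hgain' : ∀ h δ, 0 ≤ h → 0 < δ → ∀ σ ∈ Ioo 0 T, ∀ τ ∈ Ioo 0 T, σ ≤ τ →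
      (τ - σ) ^ 3 * δ ^ 2 * (∫ x, max (w τ x - (h + δ)) 0) ^ 3
        ≤ C * (∫ x, max (w σ x - h) 0) ^ 5 := by
    intro h δ hh hδ σ hσ τ hτ hστ
    have key := hgain T v _ hv (hw.affine hh hδ) σ hσ τ hτ hστ
    have e1 : ∀ y : ℝ, max ((y - h) / δ - 1) 0 = δ⁻¹ * max (y - (h + δ)) 0 := by
      intro y
      rw [mul_max_of_nonneg _ _ (by positivity), mul_zero]
      congr 1
      field_simp
      ring
    have e2 : ∀ y : ℝ, max ((y - h) / δ) 0 = δ⁻¹ * max (y - h) 0 := by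
      intro y
      rw [mul_max_of_nonneg _ _ (by positivity), mul_zero, inv_mul_eq_div]
    simp_rw [e1, e2, integral_const_mul] at key
    have := mul_le_mul_of_nonneg_left key (by positivity : 0 ≤ δ ^ 5)
    calc _ = δ ^ 5 * ((τ - σ) ^ 3 * (δ⁻¹ * ∫ x, max (w τ x - (h + δ)) 0) ^ 3) := by
          field_simp
      _ ≤ _ := this
      _ = _ := by field_simp
  -- Times approach `t` and levels approach `K` geometrically with ratio `1 / 2`; the mass is to
  -- decay with ratio `1 / 8`.
  have hiter : ∀ j : ℕ, ∫ x, max (w (t - (t - s) * (1 / 2) ^ j) x - K * (1 - (1 / 2) ^ j)) 0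
      ≤ (1 / 8) ^ j * m := by
    intro j
    induction j with
    | zero => simpa using hsm
    | succ j ih =>
      have h8 : ∀ n : ℕ, (1 / 8 : ℝ) ^ n = ((1 / 2 : ℝ) ^ n) ^ 3 := fun n => by
        rw [← pow_mul, mul_comm, pow_mul]; norm_num
      rw [h8] at ih ⊢
      rw [pow_succ]
      have hy0 : 0 < (1 / 2 : ℝ) ^ j := by positivity
      have hy1 : (1 / 2 : ℝ) ^ j ≤ 1 := pow_le_one₀ (by norm_num) (by norm_num)
      generalize (1 / 2 : ℝ) ^ j = y at ih hy0 hy1 ⊢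
      have hin : ∀ z ∈ Icc (0 : ℝ) 1, t - (t - s) * z ∈ Ioo 0 T := fun z hz =>
        ⟨by nlinarith [hs.1, hz.1, hz.2], by nlinarith [ht.2, hz.1, hz.2]⟩
      have key := hgain' (K * (1 - y)) (K * (y * (1 / 2))) (mul_nonneg hK.le (by linarith))
        (by positivity) _ (hin y ⟨hy0.le, hy1⟩) _ (hin (y * (1 / 2)) ⟨by positivity, by linarith⟩)
        (by nlinarith)
      rw [show K * (1 - y) + K * (y * (1 / 2)) = K * (1 - y * (1 / 2)) by ring] at key
      have hV := hU0 (K * (1 - y * (1 / 2))) (t - (t - s) * (y * (1 / 2)))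
      have hW := hU0 (K * (1 - y)) (t - (t - s) * y)
      generalize (∫ x, max (w (t - (t - s) * (y * (1 / 2))) x - K * (1 - y * (1 / 2))) 0) = V
        at key hV ⊢
      generalize (∫ x, max (w (t - (t - s) * y) x - K * (1 - y)) 0) = W at key ih hW
      have h1 : C * W ^ 5 ≤ C * (y ^ 3 * m) ^ 5 := by gcongr
      have h2 : K ^ 2 * (t - s) ^ 3 * (y ^ 5 / 32 * V ^ 3) ≤ C * (y ^ 3 * m) ^ 5 := by
        refine le_trans (le_of_eq ?_) (key.trans h1)
        ring
      -- Here `16384 = 32 * 512`: the factor `32 = 2³ · 2²` pays for the halved time and level gaps,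
      -- and `512 = 8³` for the decay of the mass. A spare factor `y` is discarded in `h6`.
      have h3 : 16384 * C * m ^ 2 * (y ^ 5 / 32 * V ^ 3) ≤ C * (y ^ 3 * m) ^ 5 :=
        le_trans (by gcongr) h2
      have h4 : C * m ^ 2 * y ^ 5 * (512 * V ^ 3) ≤ C * m ^ 2 * y ^ 5 * (y ^ 10 * m ^ 3) := by
        calc _ = 16384 * C * m ^ 2 * (y ^ 5 / 32 * V ^ 3) := by ring
          _ ≤ _ := h3
          _ = _ := by ring
      have h5 : 512 * V ^ 3 ≤ y ^ 10 * m ^ 3 := le_of_mul_le_mul_left h4 (by positivity)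
      refine le_of_pow_le_pow_left₀ three_ne_zero (by positivity) ?_
      have h6 : y ^ 10 ≤ y ^ 9 := pow_le_pow_of_le_one hy0.le hy1 (by norm_num)
      have h7 : y ^ 10 * m ^ 3 ≤ y ^ 9 * m ^ 3 := by gcongr
      calc V ^ 3 ≤ y ^ 9 * m ^ 3 / 512 := by linarith
        _ = _ := by ring
  have hKint := (hw.shift hK.le).integrable t ht
  have hzero : ∫ x, max (w t x - K) 0 ≤ 0 := by
    have hlim : Tendsto (fun j : ℕ => (1 / 8 : ℝ) ^ j * m) atTop (𝓝 (0 * m)) :=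
      (tendsto_pow_atTop_nhds_zero_of_lt_one (by norm_num) (by norm_num)).mul_const m
    rw [zero_mul] at hlim
    refine ge_of_tendsto hlim (Eventually.of_forall fun j => ?_)
    refine le_trans ?_ (hiter j)
    have hy0 : 0 < (1 / 2 : ℝ) ^ j := by positivity
    have hy1 : (1 / 2 : ℝ) ^ j ≤ 1 := pow_le_one₀ (by norm_num) (by norm_num)
    generalize (1 / 2 : ℝ) ^ j = y at hy0 hy1 ⊢
    have hk : 0 ≤ K * (1 - y) := mul_nonneg hK.le (by linarith)
    -- The mass above `K` at time `t` is below the mass above the smaller level `K * (1 - y)`, which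
    -- is then carried back to the earlier time.
    refine le_trans ?_ ((hw.shift hk).integral_posPart_antitone hv
      (s := t - (t - s) * y) (t := t) ⟨by nlinarith [hs.1], by nlinarith [ht.2]⟩ ht (by nlinarith))
    refine integral_mono hKint ((hw.shift hk).integrable t ht) fun x => ?_
    exact max_le_max (by nlinarith) le_rfl
  have h0 := (integral_eq_zero_iff_of_nonneg (fun x => le_max_right _ _) hKint).1
    (le_antisymm hzero (hU0 K t))
  filter_upwards [h0] with x hx
  have := (le_max_left (w t x - K) 0).trans_eq hx
  simpa using this

end IsTailSolution

/-! ### Level masses and pointwise bounds for `L¹` solutions -/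

namespace IsSmoothSolution

variable {T : ℝ} {v : ℝ → R3 → R3} {ρ₀ : R3 → ℝ} {ρ : ℝ → R3 → ℝ}

theorem integrable (h : IsSmoothSolution T v ρ₀ ρ) {t : ℝ} (ht : t ∈ Ico 0 T) :
    Integrable (ρ t) := memLp_one_iff_integrable.1 (h.memL1 t ht)

theorem tendsto_integral_abs_sub (h : IsSmoothSolution T v ρ₀ ρ) {s : ℝ} (hs : s ∈ Ico 0 T) :
    Tendsto (fun t => ∫ x, |ρ t x - ρ s x|) (𝓝[Ico 0 T] s) (𝓝 0) := by
  have := (ENNReal.tendsto_toReal ENNReal.zero_ne_top).comp (h.contL1 s hs)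
  rw [ENNReal.toReal_zero] at this
  refine this.congr' ?_
  filter_upwards [self_mem_nhdsWithin] with t ht
  have hi : Integrable (ρ t - ρ s) := (h.integrable ht).sub (h.integrable hs)
  rw [Function.comp_apply, eLpNorm_one_eq_lintegral_enorm, ← integral_norm_eq_lintegral_enorm hi.1]
  rfl

theorem neg (h : IsSmoothSolution T v ρ₀ ρ) :
    IsSmoothSolution T v (fun x => -ρ₀ x) fun t x => -ρ t x := by
  refine ⟨h.smooth.neg, fun t ht x => ?_, fun t ht => (h.memL1 t ht).neg, fun s hs => ?_, ?_⟩
  · have e := h.eqn t ht x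
    have e1 : deriv (fun s => -ρ s x) t = -deriv (fun s => ρ s x) t := deriv.fun_neg
    have e2 : fderiv ℝ (fun x => -ρ t x) x = -fderiv ℝ (ρ t) x := fderiv_fun_neg
    have e3 : (Δ fun x => -ρ t x) x = -(Δ (ρ t)) x := by
      have := InnerProductSpace.laplacian_neg (f := ρ t)
      exact congrFun this x
    rw [e1, e2, e3]
    simp only [_root_.neg_apply]
    linarith
  · refine (h.contL1 s hs).congr fun t => ?_
    rw [← eLpNorm_neg]
    congr 1
    ext x
    simp
    ring
  · filter_upwards [h.initial] with x hx
    rw [hx]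

/-- At one time the tail is small by dominated convergence; `L¹` continuity extends this to a
neighbourhood, and compactness of the time interval to a common radius. -/
theorem exists_tail (h : IsSmoothSolution T v ρ₀ ρ) {a b : ℝ} (ha : 0 ≤ a) (hb : b < T) {ε : ℝ}
    (hε : 0 < ε) : ∃ R₀ : ℝ, ∀ R ≥ R₀, ∀ t ∈ Icc a b, ∫ x in {x | R ≤ ‖x‖}, |ρ t x| ≤ ε := by
  have hT : Icc a b ⊆ Ico 0 T := fun t ht => ⟨ha.trans ht.1, ht.2.trans_lt hb⟩
  -- Membership in `Ico 0 T` enters the inductive predicate because the neighbourhoods used may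
  -- leave `Icc a b`.
  suffices H : ∃ R₀ : ℝ, ∀ R ≥ R₀, ∀ t ∈ Icc a b, t ∈ Ico 0 T →
      ∫ x in {x | R ≤ ‖x‖}, |ρ t x| ≤ ε by
    obtain ⟨R₀, h₀⟩ := H
    exact ⟨R₀, fun R hR t ht => h₀ R hR t ht (hT ht)⟩
  refine isCompact_Icc.induction_on (p := fun S => ∃ R₀ : ℝ, ∀ R ≥ R₀, ∀ t ∈ S, t ∈ Ico 0 T →
      ∫ x in {x | R ≤ ‖x‖}, |ρ t x| ≤ ε) ⟨0, by simp⟩ ?_ ?_ ?_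
  · rintro S S' hS ⟨R₀, h₀⟩
    exact ⟨R₀, fun R hR t ht => h₀ R hR t (hS ht)⟩
  · rintro S S' ⟨R₀, h₀⟩ ⟨R₁, h₁⟩
    refine ⟨max R₀ R₁, fun R hR t ht hT => ?_⟩
    rcases ht with ht | ht
    · exact h₀ R ((le_max_left _ _).trans hR) t ht hT
    · exact h₁ R ((le_max_right _ _).trans hR) t ht hT
  · intro s hs
    have hsT := hT hs
    have hsi := (h.integrable hsT).abs
    have hm : ∀ R : ℝ, MeasurableSet {x : R3 | R ≤ ‖x‖} := fun R =>
      (isClosed_le continuous_const continuous_norm).measurableSet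
    have htail : Tendsto (fun R : ℝ => ∫ x in {x | R ≤ ‖x‖}, |ρ s x|) atTop (𝓝 0) := by
      have := tendsto_integral_filter_of_dominated_convergence (l := (atTop : Filter ℝ))
        (F := fun R => {x : R3 | R ≤ ‖x‖}.indicator fun x => |ρ s x|) (f := fun _ => (0 : ℝ))
        (fun x => |ρ s x|)
        (Eventually.of_forall fun R => (hsi.indicator (hm R)).1)
        (Eventually.of_forall fun R => Eventually.of_forall fun x => by
          refine (norm_indicator_le_norm_self _ _).trans_eq ?_
          simp)
        hsi (Eventually.of_forall fun x => by
          refine tendsto_const_nhds.congr' ?_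
          filter_upwards [eventually_gt_atTop ‖x‖] with R hR
          rw [indicator_of_notMem (by simpa using hR)])
      simpa only [integral_indicator (hm _), integral_zero] using this
    obtain ⟨R₀, h₀⟩ := eventually_atTop.1 (htail.eventually_le_const (half_pos hε))
    have hev := (h.tendsto_integral_abs_sub hsT).eventually_le_const (half_pos hε)
    rw [eventually_nhdsWithin_iff] at hev
    refine ⟨{t | t ∈ Ico 0 T → ∫ x, |ρ t x - ρ s x| ≤ ε / 2}, mem_nhdsWithin_of_mem_nhds hev, R₀,
      fun R hR t ht htT => ?_⟩
    have hdi : Integrable fun x => |ρ t x - ρ s x| :=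
      ((h.integrable htT).sub (h.integrable hsT)).abs
    calc ∫ x in {x | R ≤ ‖x‖}, |ρ t x|
        ≤ ∫ x in {x | R ≤ ‖x‖}, |ρ t x - ρ s x| + |ρ s x| := by
          refine integral_mono (h.integrable htT).abs.integrableOn
            (hdi.add hsi).integrableOn fun x => ?_
          have := abs_add_le (ρ t x - ρ s x) (ρ s x)
          simpa using this
      _ = (∫ x in {x | R ≤ ‖x‖}, |ρ t x - ρ s x|) + ∫ x in {x | R ≤ ‖x‖}, |ρ s x| :=
          integral_add hdi.integrableOn hsi.integrableOn
      _ ≤ ε / 2 + ε / 2 := by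
          refine add_le_add ?_ (h₀ R hR)
          refine le_trans ?_ (ht htT)
          exact setIntegral_le_integral hdi (Eventually.of_forall fun x => abs_nonneg _)
      _ = ε := add_halves ε

theorem isTailSolution (h : IsSmoothSolution T v ρ₀ ρ) : IsTailSolution T v ρ := by
  have hI : ∀ t ∈ Ioo 0 T, t ∈ Ico 0 T := fun t ht => ⟨ht.1.le, ht.2⟩
  refine ⟨h.smooth, h.eqn, fun t ht => (h.integrable (hI t ht)).pos_part,
    fun a ha b hb ε hε => ?_⟩
  obtain ⟨R₀, h₀⟩ := h.exists_tail ha.1.le hb.2 hε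
  refine ⟨R₀, fun R hR t ht => le_trans ?_ (h₀ R hR t ht)⟩
  have hi := h.integrable (t := t) ⟨ha.1.le.trans ht.1, ht.2.trans_lt hb.2⟩
  exact integral_mono hi.pos_part.integrableOn hi.abs.integrableOn fun x =>
    max_le (le_abs_self _) (abs_nonneg _)

theorem integrable_posPart_sub {f : R3 → ℝ} (hf : Integrable f) {k : ℝ} (hk : 0 ≤ k) :
    Integrable fun x => max (f x - k) 0 := by
  refine hf.abs.mono' ?_ (Eventually.of_forall fun x => ?_)
  · exact ((hf.aemeasurable.sub_const k).max aemeasurable_const).aestronglyMeasurable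
  · rw [Real.norm_of_nonneg (le_max_right _ _)]
    exact max_le ((sub_le_self _ hk).trans (le_abs_self _)) (abs_nonneg _)

/-- Monotonicity is available only between positive times. The initial time is reached by letting `τ
→ 0⁺`, as `y ↦ (y - k)₊` is 1-Lipschitz and `ρ` is continuous in `L¹`. -/
theorem integral_posPart_sub_le (hv : IsVelocityField T v) (h : IsSmoothSolution T v ρ₀ ρ) {k : ℝ}
    (hk : 0 ≤ k) {t : ℝ} (ht : t ∈ Ioo 0 T) :
    ∫ x, max (ρ t x - k) 0 ≤ ∫ x, max (ρ₀ x - k) 0 := by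
  have h0T : (0 : ℝ) ∈ Ico 0 T := ⟨le_rfl, ht.1.trans ht.2⟩
  have e : ∫ x, max (ρ₀ x - k) 0 = ∫ x, max (ρ 0 x - k) 0 := by
    refine integral_congr_ae ?_
    filter_upwards [h.initial] with x hx
    rw [hx]
  rw [e]
  have hlim : Tendsto (fun τ => (∫ x, |ρ τ x - ρ 0 x|) + ∫ x, max (ρ 0 x - k) 0) (𝓝[>] 0)
      (𝓝 (0 + ∫ x, max (ρ 0 x - k) 0)) := by
    refine Tendsto.add_const _ ((h.tendsto_integral_abs_sub h0T).mono_left ?_)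
    rw [← nhdsWithin_Ioo_eq_nhdsGT h0T.2]
    exact nhdsWithin_mono _ Ioo_subset_Ico_self
  rw [zero_add] at hlim
  refine ge_of_tendsto hlim ?_
  filter_upwards [Ioo_mem_nhdsGT ht.1] with τ hτ
  have hτT : τ ∈ Ioo 0 T := ⟨hτ.1, hτ.2.trans ht.2⟩
  have hi := h.integrable (t := τ) ⟨hτ.1.le, hτT.2⟩
  have hd : Integrable fun x => |ρ τ x - ρ 0 x| := (hi.sub (h.integrable h0T)).abs
  refine ((h.isTailSolution.shift hk).integral_posPart_antitone hv hτT ht hτ.2.le).trans ?_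
  have hi0 := integrable_posPart_sub (h.integrable h0T) hk
  rw [← integral_add hd hi0]
  refine integral_mono (integrable_posPart_sub hi hk) (hd.add hi0) fun x => ?_
  have h1 := le_abs_self (ρ τ x - ρ 0 x)
  have h2 := le_max_left (ρ 0 x - k) 0
  have h3 := le_max_right (ρ 0 x - k) 0
  have h4 := abs_nonneg (ρ τ x - ρ 0 x)
  exact max_le (by linarith) (by linarith)

theorem max_abs_sub_eq (y : ℝ) {k : ℝ} (hk : 0 ≤ k) :
    max (|y| - k) 0 = max (y - k) 0 + max (-y - k) 0 := by
  rcases le_total 0 y with hy | hy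
  · rw [abs_of_nonneg hy, max_eq_right (a := -y - k) (by linarith), add_zero]
  · rw [abs_of_nonpos hy, max_eq_right (a := y - k) (by linarith), zero_add]

/-- The mass of `|ρ|` above any level is nonincreasing. -/
theorem integral_max_abs_sub_le (hv : IsVelocityField T v) (h : IsSmoothSolution T v ρ₀ ρ)
    (h₀ : Integrable ρ₀) {k : ℝ} (hk : 0 ≤ k) {t : ℝ} (ht : t ∈ Ioo 0 T) :
    ∫ x, max (|ρ t x| - k) 0 ≤ ∫ x, max (|ρ₀ x| - k) 0 := by
  have hi := h.integrable (t := t) ⟨ht.1.le, ht.2⟩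
  simp_rw [max_abs_sub_eq _ hk]
  rw [integral_add (integrable_posPart_sub hi hk) (integrable_posPart_sub (f := fun x => -ρ t x) hi.neg hk),
    integral_add (integrable_posPart_sub h₀ hk) (integrable_posPart_sub (f := fun x => -ρ₀ x) h₀.neg hk)]
  exact add_le_add (h.integral_posPart_sub_le hv hk ht) (h.neg.integral_posPart_sub_le hv hk ht)

/-- The smoothing estimate from `L¹` to `L^∞`. -/
theorem exists_ae_abs_le : ∃ C : ℝ, 0 < C ∧ ∀ (T : ℝ) (v : ℝ → R3 → R3) (ρ₀ : R3 → ℝ)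
    (ρ : ℝ → R3 → ℝ), IsVelocityField T v → IsSmoothSolution T v ρ₀ ρ → Integrable ρ₀ →
      ∀ t ∈ Ioo 0 T, ∀ᵐ x, |ρ t x| ≤ C * t ^ (-(3 / 2) : ℝ) * ∫ x, |ρ₀ x| := by
  obtain ⟨C, hC, hgain⟩ := IsTailSolution.exists_mass_gain
  -- The iteration runs on `[t / 2, t]`, so `(t / 2) ^ 3` contributes a factor `8`, and `131072 = 8
  -- * 16384`.
  have one_sided : ∀ (T : ℝ) (v : ℝ → R3 → R3) (ρ₀ : R3 → ℝ) (ρ : ℝ → R3 → ℝ),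
      IsVelocityField T v → IsSmoothSolution T v ρ₀ ρ → Integrable ρ₀ →
      ∀ t ∈ Ioo 0 T, ∀ᵐ x, ρ t x ≤ √(131072 * C) * t ^ (-(3 / 2) : ℝ) * ∫ x, |ρ₀ x| := by
    intro T v ρ₀ ρ hv h h₀ t ht
    have ht0 : 0 < t := ht.1
    have ht2 : t / 2 ∈ Ioo 0 T := ⟨by linarith, by linarith [ht.2]⟩
    set m := ∫ x, |ρ₀ x|
    have hm : 0 ≤ m := integral_nonneg fun x => abs_nonneg _
    have hsm : ∫ x, max (ρ (t / 2) x) 0 ≤ m := by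
      have := h.integral_posPart_sub_le hv le_rfl ht2
      simp only [sub_zero] at this
      refine this.trans (integral_mono h₀.pos_part h₀.abs fun x => ?_)
      exact max_le (le_abs_self _) (abs_nonneg _)
    -- The iteration requires a strictly positive mass bound and level, while `m` may vanish; hence
    -- the added `1 / (n + 1)`.
    have key : ∀ n : ℕ, ∀ᵐ x,
        ρ t x ≤ √(131072 * C) * t ^ (-(3 / 2) : ℝ) * (m + 1 / (n + 1)) := by
      intro n
      have hn : (0 : ℝ) < 1 / (n + 1) := by positivity
      refine IsTailSolution.ae_le_of_mass_le hC hgain hv h.isTailSolution ht2 ht (by linarith)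
        (m := m + 1 / (n + 1)) (by linarith) (by linarith) (by positivity) ?_
      have e : (t ^ (-(3 / 2) : ℝ)) ^ 2 * t ^ 3 = 1 := by
        rw [← Real.rpow_natCast, ← Real.rpow_mul ht0.le, ← Real.rpow_natCast t 3,
          ← Real.rpow_add ht0]
        norm_num
      rw [mul_pow, mul_pow, Real.sq_sqrt (by positivity)]
      apply le_of_eq
      calc _ = 16384 * C * (m + 1 / (n + 1)) ^ 2 * 1 := by ring
        _ = _ := by rw [← e]; ring
    filter_upwards [ae_all_iff.2 key] with x hx
    have hlim : Tendsto (fun n : ℕ => √(131072 * C) * t ^ (-(3 / 2) : ℝ) * (m + 1 / ((n : ℝ) + 1)))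
        atTop (𝓝 (√(131072 * C) * t ^ (-(3 / 2) : ℝ) * (m + 0))) :=
      (tendsto_one_div_add_atTop_nhds_zero_nat.const_add m).const_mul _
    rw [add_zero] at hlim
    exact ge_of_tendsto hlim (Eventually.of_forall hx)
  refine ⟨√(131072 * C), by positivity, fun T v ρ₀ ρ hv h h₀ t ht => ?_⟩
  have h2 := one_sided T v _ _ hv h.neg h₀.neg t ht
  simp only [abs_neg] at h2
  filter_upwards [one_sided T v ρ₀ ρ hv h h₀ t ht, h2] with x hx hx'
  exact abs_le.2 ⟨by linarith, hx⟩

end IsSmoothSolution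

/-! ### Monotonicity of all `L^p` norms -/

/-- Powers with exponent above `1` are superpositions of the truncations `a ↦ (a - k)₊`. -/
theorem ofReal_rpow_eq_lintegral_max_sub {p : ℝ} (hp : 1 < p) {a : ℝ} (ha : 0 ≤ a) :
    ENNReal.ofReal (a ^ p) = ∫⁻ k in Ioi (0 : ℝ),
      ENNReal.ofReal (p * (p - 1) * k ^ (p - 2)) * ENNReal.ofReal (max (a - k) 0) := by
  have hc : 0 ≤ p * (p - 1) := mul_nonneg (by linarith) (by linarith)
  have i1 : IntervalIntegrable (fun k : ℝ => k ^ (p - 2)) volume 0 a :=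
    intervalIntegral.intervalIntegrable_rpow' (by linarith)
  have i2 : IntervalIntegrable (fun k : ℝ => k ^ (p - 1)) volume 0 a :=
    intervalIntegral.intervalIntegrable_rpow' (by linarith)
  have hpow : ∀ k ∈ Ioc 0 a, p * (p - 1) * k ^ (p - 2) * (a - k)
      = p * (p - 1) * a * k ^ (p - 2) - p * (p - 1) * k ^ (p - 1) := by
    intro k hk
    rw [show p - 1 = p - 2 + 1 by ring, Real.rpow_add_one hk.1.ne']
    ring
  have hval : ∫ k in Ioc 0 a, p * (p - 1) * k ^ (p - 2) * (a - k) = a ^ p := by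
    rw [setIntegral_congr_fun measurableSet_Ioc hpow, ← intervalIntegral.integral_of_le ha,
      intervalIntegral.integral_sub (i1.const_mul _) (i2.const_mul _),
      intervalIntegral.integral_const_mul, intervalIntegral.integral_const_mul,
      integral_rpow (Or.inl (by linarith)), integral_rpow (Or.inl (by linarith)),
      Real.zero_rpow (by linarith), Real.zero_rpow (by linarith)]
    have h1 : p - 1 ≠ 0 := by linarith
    have h2 : p ≠ 0 := by linarith
    have h3 : a ^ p = a ^ (p - 1) * a := by
      rw [← Real.rpow_add_one' ha (by simpa using h2)]; simp
    rw [show p - 2 + 1 = p - 1 by ring, show p - 1 + 1 = p by ring, h3]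
    field_simp
    ring
  have hint : IntegrableOn (fun k => p * (p - 1) * k ^ (p - 2) * (a - k)) (Ioc 0 a) := by
    rw [integrableOn_congr_fun hpow measurableSet_Ioc, ← intervalIntegrable_iff_integrableOn_Ioc_of_le ha]
    exact (i1.const_mul _).sub (i2.const_mul _)
  rw [← hval, ofReal_integral_eq_lintegral_ofReal hint]
  · rw [← Ioc_union_Ioi_eq_Ioi ha, lintegral_union measurableSet_Ioi (Ioc_disjoint_Ioi le_rfl)]
    have hz : ∫⁻ k in Ioi a, ENNReal.ofReal (p * (p - 1) * k ^ (p - 2))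
        * ENNReal.ofReal (max (a - k) 0) = 0 := by
      rw [setLIntegral_congr_fun (g := fun _ => 0) measurableSet_Ioi fun k hk => ?_]
      · simp
      · simp only [mem_Ioi] at hk
        simp only
        rw [max_eq_right (by linarith)]
        simp
    rw [hz, add_zero]
    refine setLIntegral_congr_fun measurableSet_Ioc fun k hk => ?_
    rw [max_eq_left (sub_nonneg.2 hk.2), ENNReal.ofReal_mul
      (mul_nonneg hc (Real.rpow_nonneg hk.1.le _))]
  · refine (ae_restrict_iff' measurableSet_Ioc).2 (Eventually.of_forall fun k hk => ?_)
    exact mul_nonneg (mul_nonneg hc (Real.rpow_nonneg hk.1.le _)) (sub_nonneg.2 hk.2)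

/-- By Tonelli, the power integral becomes an increasing functional of the level masses; no
finiteness is needed. -/
theorem lintegral_enorm_rpow_eq {f : R3 → ℝ} (hf : AEMeasurable f) {p : ℝ} (hp : 1 < p) :
    ∫⁻ x, ‖f x‖ₑ ^ p = ∫⁻ k in Ioi (0 : ℝ), ENNReal.ofReal (p * (p - 1) * k ^ (p - 2))
      * ∫⁻ x, ENNReal.ofReal (max (|f x| - k) 0) := by
  have h1 : ∀ x, ‖f x‖ₑ ^ p = ∫⁻ k in Ioi (0 : ℝ),
      ENNReal.ofReal (p * (p - 1) * k ^ (p - 2)) * ENNReal.ofReal (max (|f x| - k) 0) := by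
    intro x
    rw [← ofReal_rpow_eq_lintegral_max_sub hp (abs_nonneg _), Real.enorm_eq_ofReal_abs,
      ENNReal.ofReal_rpow_of_nonneg (abs_nonneg _) (by linarith)]
  simp_rw [h1]
  rw [lintegral_lintegral_swap]
  · refine lintegral_congr fun k => ?_
    rw [lintegral_const_mul' _ _ ENNReal.ofReal_ne_top]
  · have hf1 : AEMeasurable (fun q : R3 × ℝ => f q.1) (volume.prod (volume.restrict (Ioi 0))) :=
      hf.comp_fst
    have h2 : AEMeasurable (fun q : R3 × ℝ => ENNReal.ofReal (p * (p - 1) * q.2 ^ (p - 2)))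
        (volume.prod (volume.restrict (Ioi 0))) := Measurable.aemeasurable (by fun_prop)
    have h3 : AEMeasurable (fun q : R3 × ℝ => ENNReal.ofReal (max (|f q.1| - q.2) 0))
        (volume.prod (volume.restrict (Ioi 0))) :=
      ((hf1.norm.sub measurable_snd.aemeasurable).max aemeasurable_const).ennreal_ofReal
    exact h2.mul h3

namespace IsSmoothSolution

variable {T : ℝ} {v : ℝ → R3 → R3} {ρ₀ : R3 → ℝ} {ρ : ℝ → R3 → ℝ}

theorem eLpNorm_le (hv : IsVelocityField T v) (h : IsSmoothSolution T v ρ₀ ρ)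
    (h₀ : Integrable ρ₀) {p : ℝ≥0∞} (hp : 1 ≤ p) {t : ℝ} (ht : t ∈ Ico 0 T) :
    eLpNorm (ρ t) p volume ≤ eLpNorm ρ₀ p volume := by
  rcases ht.1.eq_or_lt with rfl | ht0
  · exact (eLpNorm_congr_ae h.initial).le
  have htT : t ∈ Ioo 0 T := ⟨ht0, ht.2⟩
  have hi := h.integrable ht
  have hlevel : ∀ k : ℝ, 0 ≤ k → ∫⁻ x, ENNReal.ofReal (max (|ρ t x| - k) 0)
      ≤ ∫⁻ x, ENNReal.ofReal (max (|ρ₀ x| - k) 0) := by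
    intro k hk
    have i1 := integrable_posPart_sub hi.abs hk
    have i2 := integrable_posPart_sub h₀.abs hk
    rw [← ofReal_integral_eq_lintegral_ofReal i1 (Eventually.of_forall fun x => le_max_right _ _),
      ← ofReal_integral_eq_lintegral_ofReal i2 (Eventually.of_forall fun x => le_max_right _ _)]
    exact ENNReal.ofReal_le_ofReal (h.integral_max_abs_sub_le hv h₀ hk htT)
  rcases eq_or_ne p ⊤ with rfl | hp_top
  · rcases eq_or_ne (eLpNorm ρ₀ ⊤ volume) ⊤ with h_top | h_top
    · rw [h_top]; exact le_top
    -- At this level the initial mass is zero, hence so is the mass at time `t`.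
    set k := (eLpNorm ρ₀ ⊤ volume).toReal
    have hk : 0 ≤ k := ENNReal.toReal_nonneg
    have hb : ∀ᵐ x, |ρ₀ x| ≤ k := by
      filter_upwards [ae_le_eLpNormEssSup (f := ρ₀) (μ := volume)] with x hx
      rw [← eLpNorm_exponent_top] at hx
      have := ENNReal.toReal_mono h_top hx
      rwa [toReal_enorm] at this
    have hz : ∫ x, max (|ρ t x| - k) 0 ≤ 0 := by
      refine (h.integral_max_abs_sub_le hv h₀ hk htT).trans_eq ?_
      refine integral_eq_zero_of_ae ?_
      filter_upwards [hb] with x hx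
      simpa using hx
    have h0 := (integral_eq_zero_iff_of_nonneg (fun x => le_max_right _ _)
      (integrable_posPart_sub hi.abs hk)).1
      (le_antisymm hz (integral_nonneg fun x => le_max_right _ _))
    rw [← ENNReal.ofReal_toReal h_top, eLpNorm_exponent_top]
    refine eLpNormEssSup_le_of_ae_bound ?_
    filter_upwards [h0] with x hx
    exact sub_nonpos.1 ((le_max_left (|ρ t x| - k) 0).trans_eq hx)
  rcases hp.eq_or_lt with rfl | hp1
  · have := hlevel 0 le_rfl
    have e : ∀ y : ℝ, max |y| 0 = |y| := fun y => max_eq_left (abs_nonneg y)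
    simpa only [sub_zero, e, eLpNorm_one_eq_lintegral_enorm,
      Real.enorm_eq_ofReal_abs] using this
  · have hp1' : 1 < p.toReal := by
      rw [← ENNReal.toReal_one]
      exact (ENNReal.toReal_lt_toReal ENNReal.one_ne_top hp_top).2 hp1
    have hp0 : p ≠ 0 := (zero_lt_one.trans hp1).ne'
    rw [eLpNorm_eq_lintegral_rpow_enorm_toReal hp0 hp_top,
      eLpNorm_eq_lintegral_rpow_enorm_toReal hp0 hp_top,
      lintegral_enorm_rpow_eq hi.aemeasurable hp1', lintegral_enorm_rpow_eq h₀.aemeasurable hp1']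
    gcongr ?_ ^ _
    refine setLIntegral_mono' measurableSet_Ioi fun k hk => ?_
    exact mul_le_mul_right (hlevel k (le_of_lt hk)) _

end IsSmoothSolution

/-! ### Interpolation and conclusion -/

/-- Interpolation between a bound in `L¹` and a uniform bound. -/
theorem eLpNorm_le_of_ae_abs_le {f : R3 → ℝ} {A m : ℝ} (hA : 0 ≤ A) (hm : 0 ≤ m)
    (hfA : ∀ᵐ x, |f x| ≤ A) (hfm : eLpNorm f 1 volume ≤ ENNReal.ofReal m) {p : ℝ≥0∞}
    (hp : 1 ≤ p) (hp_top : p ≠ ⊤) : eLpNorm f p volume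
      ≤ ENNReal.ofReal ((A ^ (p.toReal - 1) * m) ^ (1 / p.toReal)) := by
  have hp0 : p ≠ 0 := (zero_lt_one.trans_le hp).ne'
  have hp1 : 1 ≤ p.toReal := by
    rw [← ENNReal.toReal_one]
    exact ENNReal.toReal_mono hp_top hp
  have hAp : 0 ≤ A ^ (p.toReal - 1) := Real.rpow_nonneg hA _
  rw [eLpNorm_eq_lintegral_rpow_enorm_toReal hp0 hp_top,
    ← ENNReal.ofReal_rpow_of_nonneg (by positivity) (by positivity)]
  gcongr
  rw [ENNReal.ofReal_mul hAp]
  calc ∫⁻ x, ‖f x‖ₑ ^ p.toReal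
      ≤ ∫⁻ x, ENNReal.ofReal (A ^ (p.toReal - 1)) * ‖f x‖ₑ := by
        refine lintegral_mono_ae ?_
        filter_upwards [hfA] with x hx
        rw [Real.enorm_eq_ofReal_abs, ENNReal.ofReal_rpow_of_nonneg (abs_nonneg _) (by linarith),
          ← ENNReal.ofReal_mul hAp]
        apply ENNReal.ofReal_le_ofReal
        calc |f x| ^ p.toReal = |f x| ^ (p.toReal - 1) * |f x| := by
              rw [← Real.rpow_add_one' (abs_nonneg _) (by simp; linarith)]; simp
          _ ≤ _ := by
              gcongr
    _ = ENNReal.ofReal (A ^ (p.toReal - 1)) * eLpNorm f 1 volume := by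
        rw [lintegral_const_mul' _ _ ENNReal.ofReal_ne_top, eLpNorm_one_eq_lintegral_enorm]
    _ ≤ _ := by gcongr

theorem proposition4p4 :
    ∃ C : ℝ≥0∞ → ℝ,
      (∀ p : ℝ≥0∞, 1 ≤ p → 0 < C p) ∧
      (∃ M : ℝ, ∀ p : ℝ≥0∞, 1 ≤ p → C p ≤ M) ∧
      ∀ (T : ℝ) (v : ℝ → R3 → R3) (ρ₀ : R3 → ℝ) (ρ : ℝ → R3 → ℝ),
        0 < T → MemLp ρ₀ 1 volume → IsVelocityField T v → IsSmoothSolution T v ρ₀ ρ →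
        ∀ p : ℝ≥0∞, 1 ≤ p →
          (∀ t ∈ Ico 0 T, eLpNorm (ρ t) p volume ≤ eLpNorm ρ₀ p volume) ∧
          (∀ t ∈ Ioo 0 T, eLpNorm (ρ t) p volume ≤
            ENNReal.ofReal (C p * t ^ (-(3 / 2 : ℝ) * (1 - (1 / p).toReal))) *
              eLpNorm ρ₀ 1 volume) := by
  obtain ⟨C, hC, hsup⟩ := IsSmoothSolution.exists_ae_abs_le
  have hC1 : 0 < max C 1 := lt_max_of_lt_left hC
  -- Interpolation produces the constant `C ^ (1 - 1 / p)`, whose exponent lies in `[0, 1]`; `max C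
  -- 1` dominates it for every `p`.
  refine ⟨fun _ => max C 1, fun _ _ => hC1, ⟨max C 1, fun _ _ => le_rfl⟩,
    fun T v ρ₀ ρ _ h₀ hv h p hp => ?_⟩
  rw [memLp_one_iff_integrable] at h₀
  refine ⟨fun t ht => h.eLpNorm_le hv h₀ hp ht, fun t ht => ?_⟩
  have ht0 : 0 < t := ht.1
  set m := ∫ x, |ρ₀ x|
  have hm : 0 ≤ m := integral_nonneg fun x => abs_nonneg _
  have hm1 : eLpNorm ρ₀ 1 volume = ENNReal.ofReal m := by
    rw [eLpNorm_one_eq_lintegral_enorm, ← ofReal_integral_norm_eq_lintegral_enorm h₀]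
    rfl
  have hbd := hsup T v ρ₀ ρ hv h h₀ t ht
  rw [hm1, ← ENNReal.ofReal_mul (by positivity)]
  rcases eq_or_ne p ⊤ with rfl | hp_top
  · rw [eLpNorm_exponent_top]
    refine eLpNormEssSup_le_of_ae_bound ?_
    filter_upwards [hbd] with x hx
    rw [Real.norm_eq_abs]
    refine hx.trans ?_
    simp only [ENNReal.div_top, ENNReal.toReal_zero, sub_zero, mul_one]
    gcongr
    exact le_max_left _ _
  · have hp1 : 1 ≤ p.toReal := by
      rw [← ENNReal.toReal_one]
      exact ENNReal.toReal_mono hp_top hp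
    have hL1 : eLpNorm (ρ t) 1 volume ≤ ENNReal.ofReal m :=
      (h.eLpNorm_le hv h₀ le_rfl ⟨ht0.le, ht.2⟩).trans_eq hm1
    have hA : 0 ≤ C * t ^ (-(3 / 2) : ℝ) * m := by positivity
    refine (eLpNorm_le_of_ae_abs_le hA hm hbd hL1 hp hp_top).trans (ENNReal.ofReal_le_ofReal ?_)
    rw [one_div p, ENNReal.toReal_inv]
    set r := p.toReal
    have hr : r ≠ 0 := by linarith
    have e1 : (C * t ^ (-(3 / 2) : ℝ) * m) ^ (r - 1) * m
        = (C ^ ((r - 1) / r) * t ^ (-(3 / 2 : ℝ) * (1 - r⁻¹)) * m) ^ r := by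
      have hCt : 0 ≤ C * t ^ (-(3 / 2) : ℝ) := by positivity
      rw [Real.mul_rpow hCt hm, mul_assoc, ← Real.rpow_add_one' hm (by simpa using hr),
        sub_add_cancel, Real.mul_rpow hC.le (by positivity), Real.mul_rpow (by positivity) hm,
        Real.mul_rpow (by positivity) (by positivity), ← Real.rpow_mul hC.le,
        ← Real.rpow_mul ht0.le, ← Real.rpow_mul ht0.le]
      congr 3
      · field_simp
      · field_simp
    rw [e1, ← Real.rpow_mul (by positivity), mul_one_div_cancel hr, Real.rpow_one]
    gcongr
    have hexp0 : 0 ≤ (r - 1) / r := div_nonneg (by linarith) (by linarith)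
    have hexp1 : (r - 1) / r ≤ 1 := (div_le_one (by linarith)).2 (by linarith)
    calc C ^ ((r - 1) / r) ≤ (max C 1) ^ ((r - 1) / r) :=
          Real.rpow_le_rpow hC.le (le_max_left _ _) hexp0
      _ ≤ (max C 1) ^ (1 : ℝ) := Real.rpow_le_rpow_of_exponent_le (le_max_right _ _) hexp1
      _ = max C 1 := Real.rpow_one _
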